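/- Let $\pi_0$ be a probability density on $\mathbb{R}$ that is strictly decreasing on $(0,\infty)$ and increasing on $(-\infty,0)$ and has a polynomial tail of order $\alpha>1$: there are constants $M>0$ and $0<A_1<A_2$ with $A_1|\theta|^{-\alpha}\le\pi_0(\theta)\le A_2|\theta|^{-\alpha}$ for all $|\theta|>M$. For each $n$ let $\theta^*=\theta^{*(n)}\in\mathbb{R}^n$ be a vector with exactly $s=s_n$ nonzero entries, where $s_n\ge 1$ for all large $n$ and $s_n=o(n)$, and let $y\sim N(\theta^*,I_n)$; write $E^*$ for the expectation under this law. Let $\tau=\tau_n>0$ be deterministic, let $\theta\in\mathbb{R}^n$ have the prior density $\prod_{i=1}^n\tau^{-1}\pi_0(\theta_i/\tau)$, and let $\pi(\cdot\mid y)$ be the posterior distribution of $\theta$ in the model $y\mid\theta\sim N(\theta,I_n)$. For positive sequences write $a_n\prec b_n$ if $b_n/a_n\to\infty$. For $\omega>0$ put $C_1(\omega)=\sqrt{2+\omega}+\sqrt{\omega}$ and $C_2(\omega)=\sqrt{2+\omega}+\sqrt{\omega^2/5}+\sqrt{\omega/5}$. Fix $\omega>0$ and suppose that for some constant $c\in(0,1+\omega/2)$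 one has $\tau^{\alpha-1}\ge(s/n)^c\{\log(n/s)\}^{1/2}$ for all large $n$, and that $\tau^{\alpha-1}\prec\{(s/n)\log(n/s)\}^{\alpha}$. Then $$\lim_{n\to\infty}E^*\Bigl(\pi\bigl[\|\theta-\theta^*\|_2\ge C_1(\omega)\{s\log(n/s)\}^{1/2}\,\big|\,y\bigr]\Bigr)=0 .$$ If furthermore $\tau^{\alpha-1}\prec(s/n)^\alpha\{\log(n/s)\}^{(\alpha+1)/2}$, then $$\lim_{n\to\infty}E^*\Bigl(\pi\bigl[\|\theta-\theta^*\|_1\ge s\,C_2(\omega)\{\log(n/s)\}^{1/2}\,\big|\,y\bigr]\Bigr)=0 .$$ Moreover $\lim_{\omega\downarrow0}C_1(\omega)=\lim_{\omega\downarrow0}C_2(\omega)=\sqrt2$. -/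

import Mathlib

open MeasureTheory Filter Topology Asymptotics
open scoped ENNReal

noncomputable section

namespace SparseNormalMeans

/-- `p₀` is a probability density on `ℝ` that is strictly decreasing on `(0, ∞)`, increasing on
`(-∞, 0)`, and has a polynomial tail of order `α` in both directions. The value at `0` is
unrestricted, so that densities with a pole at `0` are allowed. -/
structure IsPolynomialTailPrior (p₀ : ℝ → ℝ) (α : ℝ) : Prop where
  measurable : Measurable p₀
  nonneg : ∀ θ, 0 ≤ p₀ θ
  lintegral_eq_one : ∫⁻ θ, ENNReal.ofReal (p₀ θ) = 1
  strictAntiOn : StrictAntiOn p₀ (Set.Ioi 0)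
  monotoneOn : MonotoneOn p₀ (Set.Iio 0)
  tail : ∃ M c₁ c₂ : ℝ, 0 < M ∧ 0 < c₁ ∧ c₁ < c₂ ∧
    ∀ θ : ℝ, M < |θ| → c₁ * |θ| ^ (-α) ≤ p₀ θ ∧ p₀ θ ≤ c₂ * |θ| ^ (-α)

/-- The prior on `ℝⁿ` with deterministic global scale `τ`: independent coordinates, each with
density `θ ↦ (1/τ) p₀(θ/τ)`. -/
def prior (p₀ : ℝ → ℝ) (τ : ℝ) (n : ℕ) : Measure (Fin n → ℝ) :=
  Measure.pi fun _ => volume.withDensity fun t => ENNReal.ofReal ((1 / τ) * p₀ (t / τ))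

/-- The law `N(θ, Iₙ)` of the data vector `y` when the mean vector is `θ`. -/
def dataLaw {n : ℕ} (θ : Fin n → ℝ) : Measure (Fin n → ℝ) :=
  Measure.pi fun i => ProbabilityTheory.gaussianReal (θ i) 1

/-- The likelihood: the density of `N(θ, Iₙ)` at `y`. -/
def likelihood {n : ℕ} (y θ : Fin n → ℝ) : ℝ≥0∞ :=
  ∏ i, ProbabilityTheory.gaussianPDF (θ i) 1 (y i)

/-- The marginal density of the data at `y`. -/
def marginal (p₀ : ℝ → ℝ) (τ : ℝ) {n : ℕ} (y : Fin n → ℝ) : ℝ≥0∞ :=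
  ∫⁻ θ, likelihood y θ ∂(prior p₀ τ n)

/-- The posterior distribution of the mean vector given the data `y`, by Bayes' formula. -/
def posterior (p₀ : ℝ → ℝ) (τ : ℝ) {n : ℕ} (y : Fin n → ℝ) : Measure (Fin n → ℝ) :=
  (marginal p₀ τ y)⁻¹ • (prior p₀ τ n).withDensity (likelihood y)

/-- The expectation, for data `y` from `N(θ', Iₙ)`, of the posterior probability that the mean
vector has `ℓ_q` distance at least `r` from `θ'`. -/
def expectedPosteriorMassOutside (q : ℝ≥0∞) [Fact (1 ≤ q)] (p₀ : ℝ → ℝ) (τ : ℝ) {n : ℕ}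
    (θ' : Fin n → ℝ) (r : ℝ) : ℝ≥0∞ :=
  ∫⁻ y, posterior p₀ τ y {θ | r ≤ ‖WithLp.toLp q (θ - θ')‖} ∂(dataLaw θ')

/-- `a ≺ b` for (eventually) positive sequences: `b n / a n → ∞`. -/
def Prec (a b : ℕ → ℝ) : Prop :=
  Tendsto (fun n => b n / a n) atTop atTop

/-- The constant of the `ℓ₂` rate. -/
def C₁ (ω : ℝ) : ℝ := √(2 + ω) + √ω

/-- The constant of the `ℓ₁` rate. -/
def C₂ (ω : ℝ) : ℝ := √(2 + ω) + √(ω ^ 2 / 5) + √(ω / 5)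

end SparseNormalMeans

end

open SparseNormalMeans

noncomputable section

namespace SparseNormalMeans

open ProbabilityTheory

/-! ### Factorisation of the posterior over the coordinates -/

/-! Write `L = log (n / s)` and `lam = τ ^ (α - 1)`; the rescaled prior density is of order `lam *
|θ| ^ (-α)` away from the origin. Prior and likelihood are products, hence so is the posterior.
Markov's inequality with a test function that is a sum over coordinates then reduces both claims to
expectations in a single coordinate; no concentration inequality is needed.

On the support, `θ` is compared with the observation `y` rather than with the true mean. Take `t ^ 2
= 2 * c' * L` with `c < c' < 1 + ω / 2`. The lower bound on `τ` says that the Gaussian factor `exp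
(-t ^ 2 / 2)`, even times a polynomial in `t`, is below `lam`: once `|y| > t`, the heavy prior tail
near `y` outweighs the bulk of the prior near zero. Consequently the excess of `(θ - y) ^ 2` over `t
^ 2` has a posterior mean bounded uniformly in `y` and in the scale (`exists_lintegral_excess_le`).
The support thus costs `√s * t` in the `ℓ₂` norm, or `s * t` in the `ℓ₁` norm, up to lower order;
this gives the term `√(2 + ω)` of both constants, the other terms being slack.

Off the support, the prior puts a fixed mass on each side of zero in `[-1, 1]`, so the marginal
density is at least a multiple of the `N(0, 1)` density. Averages over null data are therefore
dominated by averages under the joint law of mean and data, and the posterior mass of `{a < |θ|}` is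
on average `O(lam * a ^ (1 - α))`. The prior may lack a second moment, so second moments are taken
with the data truncated at `4 * √L`; beyond that, a crude posterior bound `C * (1 + y ^ 2)` meets
the Gaussian tail (`exists_lintegral_null_le`). For suitable `a`, the upper bounds on `τ` make `n =
s * exp L` times the result `o(s * L)` for squared loss and `o(s * √L)` for absolute loss. -/

theorem lintegral_pi_prod {n : ℕ} (ν : Fin n → Measure ℝ) [∀ i, IsProbabilityMeasure (ν i)]
    {f : Fin n → ℝ → ℝ≥0∞} (hf : ∀ i, Measurable (f i)) :
    ∫⁻ x, ∏ i, f i (x i) ∂(Measure.pi ν) = ∏ i, ∫⁻ t, f i t ∂(ν i) := by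
  rw [lintegral_prod_eq_prod_lintegral_of_indepFun Finset.univ (fun i (x : Fin n → ℝ) => f i (x i))
    (iIndepFun_pi (μ := ν) fun i => (hf i).aemeasurable)
    fun i => (hf i).comp (measurable_pi_apply i)]
  exact Finset.prod_congr rfl fun i _ => (measurePreserving_eval ν i).lintegral_comp (hf i)

/-- The marginal density at `y` of a single observation, under the prior `ν` for its mean. -/
def coordMarginal (ν : Measure ℝ) (y : ℝ) : ℝ≥0∞ := ∫⁻ θ, gaussianPDF θ 1 y ∂ν

/-- The posterior distribution of a single mean under the prior `ν`. -/
def coordPosterior (ν : Measure ℝ) (y : ℝ) : Measure ℝ :=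
  (coordMarginal ν y)⁻¹ • ν.withDensity (fun θ => gaussianPDF θ 1 y)

theorem measurable_gaussianPDF_prod :
    Measurable (fun p : ℝ × ℝ => gaussianPDF p.1 1 p.2) :=
  measurable_uncurry_gaussianPDF.comp
    (measurable_fst.prodMk (measurable_const.prodMk measurable_snd))

theorem measurable_gaussianPDF_mean (y : ℝ) : Measurable (fun θ : ℝ => gaussianPDF θ 1 y) :=
  measurable_gaussianPDF_prod.comp (g := fun p : ℝ × ℝ => gaussianPDF p.1 1 p.2)
    (f := fun θ => (θ, y)) measurable_prodMk_right

theorem gaussianPDFReal_one (θ y : ℝ) :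
    gaussianPDFReal θ 1 y = (√(2 * Real.pi))⁻¹ * Real.exp (-(y - θ) ^ 2 / 2) := by
  simp [gaussianPDFReal]

theorem gaussianPDFReal_le_one (θ y : ℝ) : gaussianPDFReal θ 1 y ≤ 1 := by
  rw [gaussianPDFReal_one]
  refine mul_le_one₀ (inv_le_one_of_one_le₀ ?_) (Real.exp_pos _).le (Real.exp_le_one_iff.2 ?_)
  · rw [Real.one_le_sqrt]; linarith [Real.pi_gt_three]
  · nlinarith [sq_nonneg (y - θ)]

theorem coordMarginal_pos (ν : Measure ℝ) [IsProbabilityMeasure ν] (y : ℝ) :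
    0 < coordMarginal ν y := by
  refine (lintegral_pos_iff_support (measurable_gaussianPDF_mean y)).2 ?_
  have : Function.support (fun θ => gaussianPDF θ 1 y) = Set.univ :=
    Set.eq_univ_of_forall fun θ => (gaussianPDF_pos θ one_ne_zero y).ne'
  simp [this]

theorem coordMarginal_lt_top (ν : Measure ℝ) [IsProbabilityMeasure ν] (y : ℝ) :
    coordMarginal ν y < ∞ := by
  calc coordMarginal ν y ≤ ∫⁻ _, 1 ∂ν := lintegral_mono fun θ => by
        simpa [gaussianPDF] using gaussianPDFReal_le_one θ y
    _ < ∞ := by simp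

theorem measurable_coordMarginal (ν : Measure ℝ) [SFinite ν] : Measurable (coordMarginal ν) :=
  Measurable.lintegral_prod_right' (f := fun p : ℝ × ℝ => gaussianPDF p.2 1 p.1)
    (measurable_gaussianPDF_prod.comp
    (g := fun p : ℝ × ℝ => gaussianPDF p.1 1 p.2) (f := Prod.swap) measurable_swap)

instance (ν : Measure ℝ) [IsProbabilityMeasure ν] (y : ℝ) :
    IsProbabilityMeasure (coordPosterior ν y) := by
  constructor
  rw [coordPosterior, Measure.smul_apply, withDensity_apply _ MeasurableSet.univ,
    Measure.restrict_univ, smul_eq_mul]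
  exact ENNReal.inv_mul_cancel (coordMarginal_pos ν y).ne' (coordMarginal_lt_top ν y).ne

theorem lintegral_coordPosterior (ν : Measure ℝ) (y : ℝ) {f : ℝ → ℝ≥0∞} (hf : Measurable f) :
    ∫⁻ θ, f θ ∂(coordPosterior ν y) =
      (coordMarginal ν y)⁻¹ * ∫⁻ θ, f θ * gaussianPDF θ 1 y ∂ν := by
  rw [coordPosterior, lintegral_smul_measure, smul_eq_mul,
    lintegral_withDensity_eq_lintegral_mul _ (measurable_gaussianPDF_mean y) hf]
  simp [mul_comm]

theorem measurable_lintegral_coordPosterior (ν : Measure ℝ) [SFinite ν] {f : ℝ → ℝ → ℝ≥0∞}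
    (hf : Measurable (Function.uncurry f)) :
    Measurable fun y => ∫⁻ θ, f θ y ∂(coordPosterior ν y) := by
  have h : ∀ y, ∫⁻ θ, f θ y ∂(coordPosterior ν y) =
      (coordMarginal ν y)⁻¹ * ∫⁻ θ, f θ y * gaussianPDF θ 1 y ∂ν := fun y =>
    lintegral_coordPosterior ν y (hf.comp measurable_prodMk_right)
  simp_rw [h]
  refine (measurable_coordMarginal ν).inv.mul ?_
  exact Measurable.lintegral_prod_right' (f := fun p : ℝ × ℝ => f p.2 p.1 * gaussianPDF p.2 1 p.1)
    ((hf.comp measurable_swap).mul (measurable_gaussianPDF_prod.comp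
    (g := fun p : ℝ × ℝ => gaussianPDF p.1 1 p.2) (f := Prod.swap) measurable_swap))

/-- The prior of a single mean. -/
def coordPrior (p₀ : ℝ → ℝ) (τ : ℝ) : Measure ℝ :=
  volume.withDensity fun t => ENNReal.ofReal ((1 / τ) * p₀ (t / τ))

theorem marginal_eq_prod {p₀ : ℝ → ℝ} {τ : ℝ} [IsProbabilityMeasure (coordPrior p₀ τ)] {n : ℕ}
    (y : Fin n → ℝ) : marginal p₀ τ y = ∏ i, coordMarginal (coordPrior p₀ τ) (y i) :=
  lintegral_pi_prod (fun _ => coordPrior p₀ τ) fun i => measurable_gaussianPDF_mean (y i)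

theorem posterior_eq_pi {p₀ : ℝ → ℝ} {τ : ℝ} [IsProbabilityMeasure (coordPrior p₀ τ)] {n : ℕ}
    (y : Fin n → ℝ) :
    posterior p₀ τ y = Measure.pi fun i => coordPosterior (coordPrior p₀ τ) (y i) := by
  refine (Measure.pi_eq fun A hA => ?_).symm
  have hbox : (∫⁻ θ in Set.univ.pi A, likelihood y θ ∂(prior p₀ τ n)) =
      ∏ i, ∫⁻ t in A i, gaussianPDF t 1 (y i) ∂(coordPrior p₀ τ) := by
    rw [← lintegral_indicator (MeasurableSet.univ_pi hA)]
    simp_rw [← fun i => lintegral_indicator (μ := coordPrior p₀ τ)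
      (f := fun t => gaussianPDF t 1 (y i)) (hA i)]
    rw [← lintegral_pi_prod (fun _ => coordPrior p₀ τ)
      fun i => (measurable_gaussianPDF_mean (y i)).indicator (hA i)]
    refine lintegral_congr fun θ => ?_
    by_cases h : θ ∈ Set.univ.pi A
    · rw [Set.indicator_of_mem h]
      exact Finset.prod_congr rfl fun i _ =>
        (Set.indicator_of_mem (h i (Set.mem_univ i)) fun t => gaussianPDF t 1 (y i)).symm
    · rw [Set.indicator_of_notMem h]
      simp only [Set.mem_pi, not_forall] at h
      obtain ⟨i, _, hi⟩ := h
      exact (Finset.prod_eq_zero (Finset.mem_univ i) (Set.indicator_of_notMem hi _)).symm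
  rw [posterior, Measure.smul_apply, withDensity_apply _ (MeasurableSet.univ_pi hA), hbox,
    marginal_eq_prod, smul_eq_mul,
    ENNReal.prod_inv_distrib fun i _ j _ _ => Or.inl (coordMarginal_pos _ _).ne',
    ← Finset.prod_mul_distrib]
  refine Finset.prod_congr rfl fun i _ => ?_
  rw [coordPosterior, Measure.smul_apply, withDensity_apply _ (hA i), smul_eq_mul]

/-- Markov's inequality for the posterior, averaged over the data, with a test function that is a
sum over the coordinates. -/
theorem expectedPosteriorMassOutside_le {q : ℝ≥0∞} [Fact (1 ≤ q)] {p₀ : ℝ → ℝ} {τ : ℝ}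
    [IsProbabilityMeasure (coordPrior p₀ τ)] {n : ℕ} (θ' : Fin n → ℝ) {r : ℝ}
    {F : Fin n → ℝ → ℝ → ℝ≥0∞} (hF : ∀ i, Measurable (Function.uncurry (F i)))
    {K : ℝ≥0∞} (hK0 : K ≠ 0) (hK : K ≠ ∞)
    (h : ∀ θ y : Fin n → ℝ, r ≤ ‖WithLp.toLp q (θ - θ')‖ → K ≤ ∑ i, F i (θ i) (y i)) :
    expectedPosteriorMassOutside q p₀ τ θ' r ≤
      K⁻¹ * ∑ i, ∫⁻ y, ∫⁻ θ, F i θ y ∂(coordPosterior (coordPrior p₀ τ) y)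
        ∂(gaussianReal (θ' i) 1) := by
  have hFy : ∀ i y, Measurable fun θ => F i θ y := fun i y =>
    (hF i).comp measurable_prodMk_right
  have hpt : ∀ y : Fin n → ℝ, posterior p₀ τ y {θ | r ≤ ‖WithLp.toLp q (θ - θ')‖} ≤
      K⁻¹ * ∑ i, ∫⁻ θ, F i θ (y i) ∂(coordPosterior (coordPrior p₀ τ) (y i)) := by
    intro y
    rw [posterior_eq_pi]
    set μ := Measure.pi fun i => coordPosterior (coordPrior p₀ τ) (y i)
    -- From here only the one-dimensional marginals of the product posterior matter, because the
    -- test function is additive.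
    calc μ {θ | r ≤ ‖WithLp.toLp q (θ - θ')‖} ≤ μ {θ | K ≤ ∑ i, F i (θ i) (y i)} :=
          measure_mono fun θ hθ => h θ y hθ
      _ ≤ (∫⁻ θ, ∑ i, F i (θ i) (y i) ∂μ) / K :=
          meas_ge_le_lintegral_div (Finset.measurable_fun_sum _ fun i _ =>
            (hFy i (y i)).comp (measurable_pi_apply i)).aemeasurable hK0 hK
      _ = K⁻¹ * ∑ i, ∫⁻ θ, F i θ (y i) ∂(coordPosterior (coordPrior p₀ τ) (y i)) := by
          rw [ENNReal.div_eq_inv_mul, lintegral_finsetSum (f := fun i (θ : Fin n → ℝ) => F i (θ i) (y i))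
            _ fun i _ => (hFy i (y i)).comp (measurable_pi_apply i)]
          congr 1
          exact Finset.sum_congr rfl fun i _ => (measurePreserving_eval
            (fun i => coordPosterior (coordPrior p₀ τ) (y i)) i).lintegral_comp (hFy i (y i))
  have hm : ∀ i, Measurable fun y => ∫⁻ θ, F i θ y ∂(coordPosterior (coordPrior p₀ τ) y) :=
    fun i => measurable_lintegral_coordPosterior _ (hF i)
  calc expectedPosteriorMassOutside q p₀ τ θ' r
      ≤ ∫⁻ y, K⁻¹ * ∑ i, ∫⁻ θ, F i θ (y i) ∂(coordPosterior (coordPrior p₀ τ) (y i))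
          ∂(dataLaw θ') := lintegral_mono hpt
    _ = _ := by
      rw [lintegral_const_mul' _ _ (ENNReal.inv_ne_top.2 hK0), lintegral_finsetSum
        (f := fun i (y : Fin n → ℝ) =>
          ∫⁻ θ, F i θ (y i) ∂(coordPosterior (coordPrior p₀ τ) (y i)))
        _ fun i _ => (hm i).comp (measurable_pi_apply i)]
      congr 1
      exact Finset.sum_congr rfl fun i _ =>
        (measurePreserving_eval (fun i => gaussianReal (θ' i) 1) i).lintegral_comp (hm i)

/-! ### The posterior of a single mean -/

/-- The measure on `ℝ` with Lebesgue density `g`. -/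
def densityMeasure (g : ℝ → ℝ) : Measure ℝ := volume.withDensity fun θ => ENNReal.ofReal (g θ)

/-- The properties of the rescaled prior density `g` that the analysis uses, with constants that
do not depend on the scale: `g` is unimodal, its tails are of order `lam * |θ| ^ (-α)`, and both
`(0, 1]` and `[-1, 0)` have mass at least `c`. -/
structure IsScaledPrior (g : ℝ → ℝ) (lam α c A₁ A₂ B : ℝ) : Prop where
  measurable : Measurable g
  nonneg : ∀ θ, 0 ≤ g θ
  lintegral_eq_one : ∫⁻ θ, ENNReal.ofReal (g θ) = 1
  antitoneOn : AntitoneOn g (Set.Ioi 0)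
  monotoneOn : MonotoneOn g (Set.Iio 0)
  mass_pos : ENNReal.ofReal c ≤ ∫⁻ θ in Set.Ioc 0 1, ENNReal.ofReal (g θ)
  mass_neg : ENNReal.ofReal c ≤ ∫⁻ θ in Set.Ico (-1) 0, ENNReal.ofReal (g θ)
  lower : ∀ θ, 1 / 2 ≤ |θ| → A₁ * lam * |θ| ^ (-α) ≤ g θ
  upper : ∀ θ, 1 / 2 ≤ |θ| → g θ ≤ A₂ * lam * |θ| ^ (-α)
  tail : ∀ r, 0 < r →
    ∫⁻ θ in {θ | r < |θ|}, ENNReal.ofReal (g θ) ≤ ENNReal.ofReal (B * lam * r ^ (1 - α))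

theorem lintegral_comp_neg_real {f : ℝ → ℝ≥0∞} (hf : Measurable f) :
    ∫⁻ x, f (-x) = ∫⁻ x, f x :=
  (Measure.measurePreserving_neg (volume : Measure ℝ)).lintegral_comp hf

section

variable {g : ℝ → ℝ} {lam α c A₁ A₂ B : ℝ}

theorem IsScaledPrior.isProbabilityMeasure (hg : IsScaledPrior g lam α c A₁ A₂ B) :
    IsProbabilityMeasure (densityMeasure g) :=
  ⟨by rw [densityMeasure, withDensity_apply _ MeasurableSet.univ, Measure.restrict_univ,
    hg.lintegral_eq_one]⟩

theorem IsScaledPrior.measurable_ofReal (hg : IsScaledPrior g lam α c A₁ A₂ B) :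
    Measurable fun θ => ENNReal.ofReal (g θ) := hg.measurable.ennreal_ofReal

theorem IsScaledPrior.comp_neg (hg : IsScaledPrior g lam α c A₁ A₂ B) :
    IsScaledPrior (fun θ => g (-θ)) lam α c A₁ A₂ B where
  measurable := hg.measurable.comp measurable_neg
  nonneg θ := hg.nonneg _
  lintegral_eq_one := by
    rw [lintegral_comp_neg_real hg.measurable_ofReal, hg.lintegral_eq_one]
  antitoneOn x hx y hy hxy :=
    hg.monotoneOn (Set.mem_Iio.2 (neg_neg_of_pos hy)) (Set.mem_Iio.2 (neg_neg_of_pos hx))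
      (neg_le_neg hxy)
  monotoneOn x hx y hy hxy :=
    hg.antitoneOn (Set.mem_Ioi.2 (neg_pos.2 hy)) (Set.mem_Ioi.2 (neg_pos.2 hx)) (neg_le_neg hxy)
  mass_pos := by
    refine hg.mass_neg.trans (le_of_eq ?_)
    rw [← lintegral_indicator measurableSet_Ico, ← lintegral_indicator measurableSet_Ioc,
      ← lintegral_comp_neg_real (hg.measurable_ofReal.indicator measurableSet_Ico)]
    refine lintegral_congr fun x => ?_
    simp only [Set.indicator, Set.mem_Ico, Set.mem_Ioc]
    congr 1
    simp only [neg_le_neg_iff, Left.neg_neg_iff, eq_iff_iff]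
    tauto
  mass_neg := by
    refine hg.mass_pos.trans (le_of_eq ?_)
    rw [← lintegral_indicator measurableSet_Ico, ← lintegral_indicator measurableSet_Ioc,
      ← lintegral_comp_neg_real (hg.measurable_ofReal.indicator measurableSet_Ioc)]
    refine lintegral_congr fun x => ?_
    simp only [Set.indicator, Set.mem_Ico, Set.mem_Ioc]
    congr 1
    simp only [Left.neg_pos_iff, eq_iff_iff]
    constructor <;> rintro ⟨h1, h2⟩ <;> constructor <;> linarith
  lower θ hθ := by simpa using hg.lower (-θ) (by simpa using hθ)
  upper θ hθ := by simpa using hg.upper (-θ) (by simpa using hθ)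
  tail r hr := by
    refine (le_of_eq ?_).trans (hg.tail r hr)
    have hm : MeasurableSet {θ : ℝ | r < |θ|} := measurableSet_lt measurable_const (by fun_prop)
    rw [← lintegral_indicator hm, ← lintegral_indicator hm,
      ← lintegral_comp_neg_real (hg.measurable_ofReal.indicator hm)]
    refine lintegral_congr fun x => ?_
    simp [Set.indicator]

theorem lintegral_densityMeasure_mul_gaussianPDF (hg : Measurable g) (hg0 : ∀ θ, 0 ≤ g θ)
    {f : ℝ → ℝ≥0∞} (hf : Measurable f) (y : ℝ) :
    ∫⁻ θ, f θ * gaussianPDF θ 1 y ∂(densityMeasure g) =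
      ∫⁻ θ, f θ * ENNReal.ofReal (g θ * gaussianPDFReal θ 1 y) := by
  rw [densityMeasure, lintegral_withDensity_eq_lintegral_mul _ hg.ennreal_ofReal
    (show Measurable fun θ => f θ * gaussianPDF θ 1 y from hf.mul (measurable_gaussianPDF_mean y))]
  refine lintegral_congr fun θ => ?_
  simp only [Pi.mul_apply, gaussianPDF, ENNReal.ofReal_mul (hg0 θ)]
  ring

theorem coordMarginal_densityMeasure (hg : Measurable g) (hg0 : ∀ θ, 0 ≤ g θ) (y : ℝ) :
    coordMarginal (densityMeasure g) y =
      ∫⁻ θ, ENNReal.ofReal (g θ * gaussianPDFReal θ 1 y) := by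
  simpa [coordMarginal] using lintegral_densityMeasure_mul_gaussianPDF hg hg0
    (f := fun _ => 1) measurable_const y

theorem gaussianPDFReal_neg_neg (θ y : ℝ) :
    gaussianPDFReal (-θ) 1 (-y) = gaussianPDFReal θ 1 y := by
  simp only [gaussianPDFReal_one]; congr 3; ring

theorem coordMarginal_comp_neg (hg : Measurable g) (hg0 : ∀ θ, 0 ≤ g θ) (y : ℝ) :
    coordMarginal (densityMeasure fun θ => g (-θ)) (-y) = coordMarginal (densityMeasure g) y := by
  rw [coordMarginal_densityMeasure hg hg0,
    coordMarginal_densityMeasure (g := fun θ => g (-θ)) (hg.comp measurable_neg) fun θ => hg0 _,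
    ← lintegral_comp_neg_real (f := fun θ => ENNReal.ofReal (g θ * gaussianPDFReal θ 1 y))]
  · refine lintegral_congr fun θ => ?_
    rw [← gaussianPDFReal_neg_neg (-θ), neg_neg]
  · exact (hg.mul (by simp only [gaussianPDFReal_one]; fun_prop)).ennreal_ofReal

theorem lintegral_coordPosterior_comp_neg (hg : Measurable g) (hg0 : ∀ θ, 0 ≤ g θ)
    {f : ℝ → ℝ≥0∞} (hf : Measurable f) (y : ℝ) :
    ∫⁻ θ, f (-θ) ∂(coordPosterior (densityMeasure fun θ => g (-θ)) (-y)) =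
      ∫⁻ θ, f θ ∂(coordPosterior (densityMeasure g) y) := by
  rw [lintegral_coordPosterior _ _ hf,
    lintegral_coordPosterior _ _ (f := fun θ => f (-θ)) (hf.comp measurable_neg),
    coordMarginal_comp_neg hg hg0, lintegral_densityMeasure_mul_gaussianPDF hg hg0 hf,
    lintegral_densityMeasure_mul_gaussianPDF (g := fun θ => g (-θ)) (hg.comp measurable_neg)
      (fun θ => hg0 _) (f := fun θ => f (-θ)) (hf.comp measurable_neg),
    ← lintegral_comp_neg_real (f := fun θ => f θ * ENNReal.ofReal (g θ * gaussianPDFReal θ 1 y))]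
  · congr 1
    refine lintegral_congr fun θ => ?_
    rw [← gaussianPDFReal_neg_neg (-θ), neg_neg]
  · exact hf.mul (hg.mul (by simp only [gaussianPDFReal_one]; fun_prop)).ennreal_ofReal

theorem gaussianPDFReal_comm (θ y : ℝ) : gaussianPDFReal θ 1 y = gaussianPDFReal y 1 θ := by
  simp only [gaussianPDFReal_one]; congr 3; ring

/-! ### Gaussian second moments and lower bounds for the marginal density -/

theorem lintegral_sq_sub_gaussianReal (μ : ℝ) :
    ∫⁻ z, ENNReal.ofReal ((z - μ) ^ 2) ∂(gaussianReal μ 1) = 1 := by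
  have h := evariance_eq_lintegral_ofReal (id : ℝ → ℝ) (gaussianReal μ 1)
  simp only [id] at h
  rw [integral_id_gaussianReal, ← (memLp_id_gaussianReal' 2 (by simp)).ofReal_variance_eq,
    variance_id_gaussianReal] at h
  simpa using h.symm

theorem lintegral_sq_sub_mul_gaussianPDFReal (y : ℝ) :
    ∫⁻ θ, ENNReal.ofReal ((y - θ) ^ 2 * gaussianPDFReal θ 1 y) = 1 := by
  rw [← lintegral_sq_sub_gaussianReal y, gaussianReal_of_var_ne_zero _ one_ne_zero,
    lintegral_withDensity_eq_lintegral_mul _ (measurable_gaussianPDF _ _) (by fun_prop)]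
  refine lintegral_congr fun θ => ?_
  rw [Pi.mul_apply, gaussianPDF, gaussianPDFReal_comm, ENNReal.ofReal_mul (sq_nonneg _), mul_comm,
    ← neg_sub, neg_sq]

/-- For `θ ∈ (0, 1]` and `y ≥ 0` one has `(y - θ) ^ 2 ≤ y ^ 2 + 1`, so prior mass on the same side
of zero as `y` suffices. The other sign follows by reflection, which is why mass is required on both
sides. -/
theorem le_coordMarginal_of_nonneg (hg : IsScaledPrior g lam α c A₁ A₂ B) {y : ℝ} (hy : 0 ≤ y) :
    ENNReal.ofReal (Real.exp (-1 / 2) * gaussianPDFReal 0 1 y) * ENNReal.ofReal c ≤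
      coordMarginal (densityMeasure g) y := by
  rw [coordMarginal_densityMeasure hg.measurable hg.nonneg]
  refine (mul_le_mul_right hg.mass_pos _).trans ?_
  rw [← lintegral_const_mul _ hg.measurable_ofReal]
  refine le_trans (setLIntegral_mono' measurableSet_Ioc fun θ hθ => ?_) (setLIntegral_le_lintegral _ _)
  rw [← ENNReal.ofReal_mul (mul_nonneg (Real.exp_pos _).le (gaussianPDFReal_nonneg _ _ _)),
    mul_comm]
  refine ENNReal.ofReal_le_ofReal (mul_le_mul_of_nonneg_left ?_ (hg.nonneg θ))
  rw [gaussianPDFReal_one, gaussianPDFReal_one, mul_left_comm, ← Real.exp_add]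
  gcongr
  nlinarith [hθ.1, hθ.2, mul_nonneg hy hθ.1.le]

theorem le_coordMarginal (hg : IsScaledPrior g lam α c A₁ A₂ B) (y : ℝ) :
    ENNReal.ofReal (Real.exp (-1 / 2) * gaussianPDFReal 0 1 y) * ENNReal.ofReal c ≤
      coordMarginal (densityMeasure g) y := by
  rcases le_total 0 y with hy | hy
  · exact le_coordMarginal_of_nonneg hg hy
  · rw [← coordMarginal_comp_neg hg.measurable hg.nonneg, ← gaussianPDFReal_neg_neg, neg_zero]
    exact le_coordMarginal_of_nonneg hg.comp_neg (neg_nonneg.2 hy)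

/-- On `(y, y + 1]` the Gaussian kernel is at least its value at distance one, and by monotonicity
the prior is at least `g (y + 1)`. This complements `le_coordMarginal`: far from zero the polynomial
tail beats the Gaussian one. -/
theorem density_le_coordMarginal (hg : IsScaledPrior g lam α c A₁ A₂ B) {y : ℝ} (hy : 0 ≤ y) :
    ENNReal.ofReal (gaussianPDFReal 0 1 1 * g (y + 1)) ≤ coordMarginal (densityMeasure g) y := by
  rw [coordMarginal_densityMeasure hg.measurable hg.nonneg]
  calc ENNReal.ofReal (gaussianPDFReal 0 1 1 * g (y + 1))
      = ∫⁻ _ in Set.Ioc y (y + 1), ENNReal.ofReal (gaussianPDFReal 0 1 1 * g (y + 1)) := by simp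
    _ ≤ ∫⁻ θ in Set.Ioc y (y + 1), ENNReal.ofReal (g θ * gaussianPDFReal θ 1 y) := by
        refine setLIntegral_mono' measurableSet_Ioc fun θ hθ => ENNReal.ofReal_le_ofReal ?_
        rw [mul_comm]
        refine mul_le_mul (hg.antitoneOn (Set.mem_Ioi.2 (hy.trans_lt hθ.1))
          (Set.mem_Ioi.2 (by linarith)) hθ.2) ?_ (gaussianPDFReal_nonneg _ _ _) (hg.nonneg _)
        rw [gaussianPDFReal_one, gaussianPDFReal_one]
        have : (y - θ) ^ 2 ≤ 1 := by nlinarith [hθ.1, hθ.2]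
        exact mul_le_mul_of_nonneg_left (Real.exp_le_exp.2 (by linarith)) (by positivity)
    _ ≤ _ := setLIntegral_le_lintegral _ _

/-- Pointwise bound for the excess integrand at an observation below the threshold. -/
theorem excess_mul_le_of_le (hg : IsScaledPrior g lam α c A₁ A₂ B) {y t : ℝ} (hy : 0 ≤ y)
    (ht : 1 ≤ t) (hyt : y ≤ t) (θ : ℝ) :
    ((θ - y) ^ 2 - t ^ 2) * (g θ * gaussianPDFReal θ 1 y) ≤
      g (y + 1) * ((y - θ) ^ 2 * gaussianPDFReal θ 1 y) + 2 * gaussianPDFReal 0 1 y * g θ := by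
  have hk := gaussianPDFReal_nonneg θ 1 y
  have hk0 := gaussianPDFReal_nonneg 0 1 y
  have h1 := hg.nonneg θ
  have h2 := hg.nonneg (y + 1)
  have hR1 : 0 ≤ g (y + 1) * ((y - θ) ^ 2 * gaussianPDFReal θ 1 y) := by positivity
  have hR2 : 0 ≤ 2 * gaussianPDFReal 0 1 y * g θ := by positivity
  rcases le_or_gt ((θ - y) ^ 2) (t ^ 2) with h | h
  · have : ((θ - y) ^ 2 - t ^ 2) * (g θ * gaussianPDFReal θ 1 y) ≤ 0 :=
      mul_nonpos_of_nonpos_of_nonneg (by linarith) (by positivity)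
    linarith
  rcases le_total y θ with hθ | hθ
  -- To the right of `y`, an excess over `t ≥ 1` forces `θ ≥ y + 1`, where `g θ ≤ g (y + 1)`; the
  -- kernel then supplies a finite second moment.
  · have hθ' : y + 1 ≤ θ := by
      by_contra hcon
      nlinarith
    have hgg : g θ ≤ g (y + 1) :=
      hg.antitoneOn (Set.mem_Ioi.2 (by linarith)) (Set.mem_Ioi.2 (by linarith)) hθ'
    calc ((θ - y) ^ 2 - t ^ 2) * (g θ * gaussianPDFReal θ 1 y)
        ≤ (y - θ) ^ 2 * (g (y + 1) * gaussianPDFReal θ 1 y) := by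
          refine mul_le_mul (by nlinarith) (by gcongr) (by positivity) (sq_nonneg _)
      _ = g (y + 1) * ((y - θ) ^ 2 * gaussianPDFReal θ 1 y) := by ring
      _ ≤ _ := by linarith
  · have key : ((θ - y) ^ 2 - t ^ 2) * gaussianPDFReal θ 1 y ≤ 2 * gaussianPDFReal 0 1 y := by
      -- The inequality `x ≤ 2 * exp (x / 2)` for `x = (θ - y) ^ 2 - y ^ 2`, together with `y ≤ t`;
      -- the exponential turns the kernel at `θ` into the kernel at zero.
      have hx : (θ - y) ^ 2 - t ^ 2 ≤ 2 * Real.exp (((θ - y) ^ 2 - y ^ 2) / 2) := by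
        have := Real.add_one_le_exp (((θ - y) ^ 2 - y ^ 2) / 2)
        nlinarith
      calc ((θ - y) ^ 2 - t ^ 2) * gaussianPDFReal θ 1 y
          ≤ 2 * Real.exp (((θ - y) ^ 2 - y ^ 2) / 2) * gaussianPDFReal θ 1 y := by gcongr
        _ = 2 * gaussianPDFReal 0 1 y := by
          rw [gaussianPDFReal_one, gaussianPDFReal_one, mul_assoc, mul_left_comm (Real.exp _),
            ← Real.exp_add]
          congr 4
          ring
    nlinarith [mul_le_mul_of_nonneg_right key h1]

/-- Pointwise bound for the excess integrand at an observation above the threshold. -/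
theorem excess_mul_le_of_lt (hg : IsScaledPrior g lam α c A₁ A₂ B) (hα : 0 ≤ α) (hlam : 0 ≤ lam)
    (hA₂ : 0 ≤ A₂) {y t : ℝ} (ht : 1 ≤ t) (hyt : t < y)
    (hu : ∀ u, t ≤ u → (2 * u) ^ α * (u ^ 2 * Real.exp (-u ^ 2 / 2)) ≤ lam) (θ : ℝ) :
    ((θ - y) ^ 2 - t ^ 2) * (g θ * gaussianPDFReal θ 1 y) ≤
      (g (y + 1) + A₂ * 2 ^ α * (lam * y ^ (-α))) * ((y - θ) ^ 2 * gaussianPDFReal θ 1 y) +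
        lam * y ^ (-α) * g θ := by
  have hk := gaussianPDFReal_nonneg θ 1 y
  have h1 := hg.nonneg θ
  have h2 := hg.nonneg (y + 1)
  have hy : 0 < y := by linarith
  have hya : 0 ≤ y ^ (-α) := by positivity
  have hR1 : 0 ≤ g (y + 1) * ((y - θ) ^ 2 * gaussianPDFReal θ 1 y) := by positivity
  have hR3 : 0 ≤ A₂ * 2 ^ α * (lam * y ^ (-α)) * ((y - θ) ^ 2 * gaussianPDFReal θ 1 y) := by
    positivity
  have hR2 : 0 ≤ lam * y ^ (-α) * g θ := by positivity
  rw [add_mul]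
  rcases le_or_gt ((θ - y) ^ 2) (t ^ 2) with h | h
  · have : ((θ - y) ^ 2 - t ^ 2) * (g θ * gaussianPDFReal θ 1 y) ≤ 0 :=
      mul_nonpos_of_nonpos_of_nonneg (by linarith) (by positivity)
    linarith
  have hle : ∀ C, g θ ≤ C → ((θ - y) ^ 2 - t ^ 2) * (g θ * gaussianPDFReal θ 1 y) ≤
      C * ((y - θ) ^ 2 * gaussianPDFReal θ 1 y) := fun C hC =>
    calc ((θ - y) ^ 2 - t ^ 2) * (g θ * gaussianPDFReal θ 1 y)
        ≤ (y - θ) ^ 2 * (C * gaussianPDFReal θ 1 y) := by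
          refine mul_le_mul (by nlinarith) (by gcongr) (by positivity) (sq_nonneg _)
      _ = C * ((y - θ) ^ 2 * gaussianPDFReal θ 1 y) := by ring
  rcases le_total y θ with hθ | hθ
  · have hθ' : y + 1 ≤ θ := by
      by_contra hcon
      nlinarith
    have := hle _ (hg.antitoneOn (Set.mem_Ioi.2 (by linarith)) (Set.mem_Ioi.2 (by linarith)) hθ')
    linarith
  -- Above `y / 2 ≥ 1 / 2` the prior is in its tail, of order `lam * y ^ (-α)`. Below it, `u = y -
  -- θ` satisfies `u ≥ t` and `y ≤ 2 * u`, so the Gaussian kernel itself is small by `hu`.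
  rcases le_total (y / 2) θ with hθ2 | hθ2
  · have hθ0 : 0 < θ := by linarith
    have hup := hg.upper θ (by rw [abs_of_pos hθ0]; linarith)
    rw [abs_of_pos hθ0] at hup
    have hpow : θ ^ (-α) ≤ 2 ^ α * y ^ (-α) := by
      calc θ ^ (-α) ≤ (y / 2) ^ (-α) :=
            Real.rpow_le_rpow_of_nonpos (by linarith) hθ2 (by linarith)
        _ = 2 ^ α * y ^ (-α) := by
            rw [Real.div_rpow hy.le zero_le_two, Real.rpow_neg zero_le_two, div_inv_eq_mul,
              mul_comm]
    have := hle (A₂ * 2 ^ α * (lam * y ^ (-α))) (hup.trans (by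
      calc A₂ * lam * θ ^ (-α) ≤ A₂ * lam * (2 ^ α * y ^ (-α)) := by gcongr
        _ = _ := by ring))
    linarith
  · have htu : t ≤ y - θ := by
      by_contra hcon
      nlinarith
    have hu' := hu (y - θ) htu
    have hu0 : 0 < y - θ := by linarith
    have hpow : y ^ α ≤ (2 * (y - θ)) ^ α := Real.rpow_le_rpow hy.le (by linarith) hα
    have hexp : (y - θ) ^ 2 * Real.exp (-(y - θ) ^ 2 / 2) ≤ lam * y ^ (-α) := by
      rw [Real.rpow_neg hy.le, ← div_eq_mul_inv, le_div_iff₀ (by positivity), mul_comm]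
      exact (mul_le_mul_of_nonneg_right hpow (by positivity)).trans hu'
    have hk' : gaussianPDFReal θ 1 y ≤ Real.exp (-(y - θ) ^ 2 / 2) := by
      rw [gaussianPDFReal_one]
      refine mul_le_of_le_one_left (Real.exp_pos _).le (inv_le_one_of_one_le₀ ?_)
      rw [Real.one_le_sqrt]; linarith [Real.pi_gt_three]
    have : ((θ - y) ^ 2 - t ^ 2) * (g θ * gaussianPDFReal θ 1 y) ≤ lam * y ^ (-α) * g θ := by
      calc ((θ - y) ^ 2 - t ^ 2) * (g θ * gaussianPDFReal θ 1 y)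
          ≤ (y - θ) ^ 2 * (g θ * Real.exp (-(y - θ) ^ 2 / 2)) := by
            refine mul_le_mul (by nlinarith) (by gcongr) (by positivity) (sq_nonneg _)
        _ = (y - θ) ^ 2 * Real.exp (-(y - θ) ^ 2 / 2) * g θ := by ring
        _ ≤ _ := by gcongr
    linarith

/-- Both majorants integrate to their coefficients: the kernel has unit second moment as a function
of `θ`, and `g` has unit mass. -/
theorem lintegral_excess_le_add (hg : IsScaledPrior g lam α c A₁ A₂ B) {y t C D : ℝ}
    (hC : 0 ≤ C) (hD : 0 ≤ D)
    (h : ∀ θ, ((θ - y) ^ 2 - t ^ 2) * (g θ * gaussianPDFReal θ 1 y) ≤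
      C * ((y - θ) ^ 2 * gaussianPDFReal θ 1 y) + D * g θ) :
    ∫⁻ θ, ENNReal.ofReal ((θ - y) ^ 2 - t ^ 2) * gaussianPDF θ 1 y ∂(densityMeasure g) ≤
      ENNReal.ofReal C + ENNReal.ofReal D := by
  rw [lintegral_densityMeasure_mul_gaussianPDF hg.measurable hg.nonneg (by fun_prop)]
  calc ∫⁻ θ, ENNReal.ofReal ((θ - y) ^ 2 - t ^ 2) * ENNReal.ofReal (g θ * gaussianPDFReal θ 1 y)
      ≤ ∫⁻ θ, (ENNReal.ofReal C * ENNReal.ofReal ((y - θ) ^ 2 * gaussianPDFReal θ 1 y) +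
          ENNReal.ofReal D * ENNReal.ofReal (g θ)) := by
        refine lintegral_mono fun θ => ?_
        rw [← ENNReal.ofReal_mul' (mul_nonneg (hg.nonneg θ) (gaussianPDFReal_nonneg _ _ _)),
          ← ENNReal.ofReal_mul hC, ← ENNReal.ofReal_mul hD, ← ENNReal.ofReal_add
            (mul_nonneg hC (mul_nonneg (sq_nonneg _) (gaussianPDFReal_nonneg _ _ _)))
            (mul_nonneg hD (hg.nonneg θ))]
        exact ENNReal.ofReal_le_ofReal (h θ)
    _ = ENNReal.ofReal C + ENNReal.ofReal D := by
        rw [lintegral_add_right _ (hg.measurable_ofReal.const_mul _),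
          lintegral_const_mul' _ _ ENNReal.ofReal_ne_top,
          lintegral_const_mul' _ _ ENNReal.ofReal_ne_top,
          lintegral_sq_sub_mul_gaussianPDFReal, hg.lintegral_eq_one, mul_one, mul_one]

end

theorem ofReal_le_ofReal_mul_of_mul_le {a k K : ℝ} {m : ℝ≥0∞} (ha : 0 < a) (hK : 0 ≤ K)
    (h : ENNReal.ofReal (a * k) ≤ m) :
    ENNReal.ofReal (K * k) ≤ ENNReal.ofReal (K / a) * m := by
  refine le_trans (le_of_eq ?_) (mul_le_mul_right h _)
  rw [← ENNReal.ofReal_mul (by positivity)]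
  congr 1
  field_simp

/-- The posterior expectation of the excess of the squared deviation `(θ - y) ^ 2` over a
threshold `t ^ 2` is bounded, uniformly in the observation `y`. -/
theorem exists_lintegral_excess_le {α c A₁ A₂ : ℝ} (B : ℝ) (hα : 0 ≤ α) (hc : 0 < c) (hA₁ : 0 < A₁)
    (hA₂ : 0 ≤ A₂) :
    ∃ C : ℝ, 0 ≤ C ∧ ∀ (g : ℝ → ℝ) (lam : ℝ), 0 ≤ lam → IsScaledPrior g lam α c A₁ A₂ B →
      ∀ y t : ℝ, 1 ≤ t → (|y| ≤ t ∨
        ∀ u, t ≤ u → (2 * u) ^ α * (u ^ 2 * Real.exp (-u ^ 2 / 2)) ≤ lam) →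
      ∫⁻ θ, ENNReal.ofReal ((θ - y) ^ 2 - t ^ 2) ∂(coordPosterior (densityMeasure g) y) ≤
        ENNReal.ofReal C := by
  set k₁ := gaussianPDFReal 0 1 1
  have hk₁ : 0 < k₁ := gaussianPDFReal_pos _ _ _ one_ne_zero
  set e := Real.exp (-1 / 2) * c
  have he : 0 < e := by positivity
  set K := 1 + A₂ * 2 ^ α * (2 ^ α / A₁) + 2 ^ α / A₁
  have hK : 0 ≤ K := by positivity
  refine ⟨K / k₁ + 2 / e, by positivity, ?_⟩
  have main : ∀ (g : ℝ → ℝ) (lam : ℝ), 0 ≤ lam → IsScaledPrior g lam α c A₁ A₂ B →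
      ∀ y t : ℝ, 0 ≤ y → 1 ≤ t → (|y| ≤ t ∨
        ∀ u, t ≤ u → (2 * u) ^ α * (u ^ 2 * Real.exp (-u ^ 2 / 2)) ≤ lam) →
      ∫⁻ θ, ENNReal.ofReal ((θ - y) ^ 2 - t ^ 2) ∂(coordPosterior (densityMeasure g) y) ≤
        ENNReal.ofReal (K / k₁ + 2 / e) := by
    intro g lam hlam hg y t hy ht h
    have := hg.isProbabilityMeasure
    set m := coordMarginal (densityMeasure g) y
    have hm0 : m ≠ 0 := (coordMarginal_pos _ y).ne'
    have hmt : m ≠ ∞ := (coordMarginal_lt_top _ y).ne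
    have hgy := hg.nonneg (y + 1)
    have hk0 := gaussianPDFReal_nonneg 0 1 y
    have hd : ∀ K', 0 ≤ K' → ENNReal.ofReal (K' * g (y + 1)) ≤ ENNReal.ofReal (K' / k₁) * m :=
      fun K' hK' => ofReal_le_ofReal_mul_of_mul_le hk₁ hK' (density_le_coordMarginal hg hy)
    have hφ : ENNReal.ofReal (2 * gaussianPDFReal 0 1 y) ≤ ENNReal.ofReal (2 / e) * m := by
      refine ofReal_le_ofReal_mul_of_mul_le he zero_le_two ?_
      refine le_trans (le_of_eq ?_) (le_coordMarginal hg y)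
      rw [← ENNReal.ofReal_mul' hc.le]
      congr 1
      simp only [e]
      ring
    have hsuff : ∫⁻ θ, ENNReal.ofReal ((θ - y) ^ 2 - t ^ 2) * gaussianPDF θ 1 y
        ∂(densityMeasure g) ≤ ENNReal.ofReal (K / k₁ + 2 / e) * m := by
      rw [ENNReal.ofReal_add (by positivity) (by positivity), add_mul]
      rcases le_or_gt y t with hyt | hyt
      · refine (lintegral_excess_le_add hg hgy (by positivity)
          (excess_mul_le_of_le hg hy ht hyt)).trans (add_le_add ?_ hφ)
        refine le_trans (ENNReal.ofReal_le_ofReal ?_) (hd K hK)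
        refine le_mul_of_one_le_left hgy ?_
        have : 0 ≤ A₂ * 2 ^ α * (2 ^ α / A₁) + 2 ^ α / A₁ := by positivity
        simp only [K]
        linarith
      · have hu := h.resolve_left (by rw [abs_of_nonneg hy]; exact not_le.2 hyt)
        have hy1 : 1 ≤ y := by linarith
        -- Since `y + 1 ≤ 2 * y`, the lower tail bound at `y + 1` controls `lam * y ^ (-α)`. Every
        -- term becomes a multiple of `g (y + 1)`, hence of the marginal, which cancels in the
        -- posterior.
        have hlow : lam * y ^ (-α) ≤ 2 ^ α / A₁ * g (y + 1) := by
          have h1 := hg.lower (y + 1) (by rw [abs_of_pos (by linarith)]; linarith)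
          rw [abs_of_pos (by linarith)] at h1
          have h2 : 2 ^ (-α) * y ^ (-α) ≤ (y + 1) ^ (-α) := by
            rw [← Real.mul_rpow zero_le_two hy]
            exact Real.rpow_le_rpow_of_nonpos (by linarith) (by linarith) (by linarith)
          rw [div_mul_eq_mul_div, le_div_iff₀ hA₁]
          calc lam * y ^ (-α) * A₁ = 2 ^ α * (A₁ * lam * (2 ^ (-α) * y ^ (-α))) := by
                rw [Real.rpow_neg zero_le_two]
                have : (2 : ℝ) ^ α ≠ 0 := by positivity
                field_simp
            _ ≤ 2 ^ α * (A₁ * lam * (y + 1) ^ (-α)) := by gcongr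
            _ ≤ 2 ^ α * g (y + 1) := by gcongr
        have hly : 0 ≤ lam * y ^ (-α) := by positivity
        refine (lintegral_excess_le_add hg (by positivity) hly
          (excess_mul_le_of_lt hg hα hlam hA₂ ht hyt hu)).trans ?_
        rw [← ENNReal.ofReal_add (by positivity) hly]
        refine le_trans (ENNReal.ofReal_le_ofReal ?_) ((hd K hK).trans le_self_add)
        calc g (y + 1) + A₂ * 2 ^ α * (lam * y ^ (-α)) + lam * y ^ (-α)
            ≤ g (y + 1) + A₂ * 2 ^ α * (2 ^ α / A₁ * g (y + 1)) + 2 ^ α / A₁ * g (y + 1) := by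
              gcongr
          _ = K * g (y + 1) := by simp only [K]; ring
    rw [lintegral_coordPosterior _ _ (by fun_prop)]
    calc m⁻¹ * _ ≤ m⁻¹ * (ENNReal.ofReal (K / k₁ + 2 / e) * m) := mul_le_mul_right hsuff _
      _ = ENNReal.ofReal (K / k₁ + 2 / e) := by
        rw [mul_left_comm, ENNReal.inv_mul_cancel hm0 hmt, mul_one]
  intro g lam hlam hg y t ht h
  rcases le_total 0 y with hy | hy
  · exact main g lam hlam hg y t hy ht h
  · rw [← lintegral_coordPosterior_comp_neg hg.measurable hg.nonneg (by fun_prop)]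
    refine le_trans (le_of_eq (lintegral_congr fun θ => ?_))
      (main _ lam hlam hg.comp_neg (-y) t (neg_nonneg.2 hy) ht (by rwa [abs_neg]))
    congr 2
    ring

/-! ### Posterior mass away from the origin when the true mean is zero -/

/-- With the threshold `max 1 |y|` the observation is never above it, so the excess bound applies
without any condition relating the threshold to `lam`. -/
theorem exists_lintegral_sq_coordPosterior_le {α c A₁ A₂ : ℝ} (B : ℝ) (hα : 0 ≤ α) (hc : 0 < c)
    (hA₁ : 0 < A₁) (hA₂ : 0 ≤ A₂) :
    ∃ C : ℝ, 0 ≤ C ∧ ∀ (g : ℝ → ℝ) (lam : ℝ), 0 ≤ lam → IsScaledPrior g lam α c A₁ A₂ B →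
      ∀ y, ∫⁻ θ, ENNReal.ofReal (θ ^ 2) ∂(coordPosterior (densityMeasure g) y) ≤
        ENNReal.ofReal (C * (1 + y ^ 2)) := by
  obtain ⟨C, hC, h⟩ := exists_lintegral_excess_le B hα hc hA₁ hA₂
  refine ⟨2 * C + 4, by positivity, fun g lam hlam hg y => ?_⟩
  have := hg.isProbabilityMeasure
  have ht := h g lam hlam hg y (max 1 |y|) (le_max_left _ _) (Or.inl (le_max_right _ _))
  have hmax : (max 1 |y|) ^ 2 ≤ 1 + y ^ 2 := by
    rcases max_cases 1 |y| with ⟨h1, _⟩ | ⟨h1, _⟩ <;> rw [h1]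
    · nlinarith [sq_nonneg y]
    · rw [sq_abs]; linarith
  set t := max 1 |y|
  calc ∫⁻ θ, ENNReal.ofReal (θ ^ 2) ∂(coordPosterior (densityMeasure g) y)
      ≤ ∫⁻ θ, (ENNReal.ofReal 2 * ENNReal.ofReal ((θ - y) ^ 2 - t ^ 2) +
          ENNReal.ofReal (2 + 4 * y ^ 2)) ∂(coordPosterior (densityMeasure g) y) := by
        refine lintegral_mono fun θ => ?_
        rw [← ENNReal.ofReal_mul zero_le_two]
        rcases le_total 0 ((θ - y) ^ 2 - t ^ 2) with h0 | h0
        · rw [← ENNReal.ofReal_add (by positivity) (by positivity)]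
          exact ENNReal.ofReal_le_ofReal (by nlinarith [sq_nonneg (θ - 2 * y)])
        · exact (ENNReal.ofReal_le_ofReal (by nlinarith [sq_nonneg (θ - 2 * y)])).trans le_add_self
    _ = ENNReal.ofReal 2 * ∫⁻ θ, ENNReal.ofReal ((θ - y) ^ 2 - t ^ 2)
          ∂(coordPosterior (densityMeasure g) y) + ENNReal.ofReal (2 + 4 * y ^ 2) := by
        rw [lintegral_add_right _ measurable_const, lintegral_const_mul' _ _ ENNReal.ofReal_ne_top,
          lintegral_const, measure_univ, mul_one]
    _ ≤ ENNReal.ofReal 2 * ENNReal.ofReal C + ENNReal.ofReal (2 + 4 * y ^ 2) := by gcongr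
    _ ≤ ENNReal.ofReal ((2 * C + 4) * (1 + y ^ 2)) := by
        rw [← ENNReal.ofReal_mul zero_le_two, ← ENNReal.ofReal_add (by positivity) (by positivity)]
        refine ENNReal.ofReal_le_ofReal ?_
        nlinarith [mul_nonneg hC (sq_nonneg y)]

/-- Under `N(0, 1)` data, posterior expectations are dominated by expectations under the joint law
of the mean and the data. -/
theorem lintegral_coordPosterior_null_le {g : ℝ → ℝ} {lam α c A₁ A₂ B : ℝ} (hc : 0 < c)
    (hg : IsScaledPrior g lam α c A₁ A₂ B) {F : ℝ → ℝ → ℝ≥0∞}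
    (hF : Measurable (Function.uncurry F)) :
    ∫⁻ y, ∫⁻ θ, F θ y ∂(coordPosterior (densityMeasure g) y) ∂(gaussianReal 0 1) ≤
      ENNReal.ofReal (1 / (Real.exp (-1 / 2) * c)) *
        ∫⁻ θ, ∫⁻ y, F θ y ∂(gaussianReal θ 1) ∂(densityMeasure g) := by
  have := hg.isProbabilityMeasure
  set e := Real.exp (-1 / 2) * c
  have he : 0 < e := by positivity
  have hFy : ∀ y, Measurable fun θ => F θ y := fun y => hF.comp measurable_prodMk_right
  have hFθ : ∀ θ, Measurable fun y => F θ y := fun θ => hF.comp measurable_prodMk_left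
  -- The ratio of the null density to the marginal is bounded, so the normalisation of the posterior
  -- cancels and Tonelli's theorem can exchange mean and data.
  have hφ : ∀ y, gaussianPDF 0 1 y * (coordMarginal (densityMeasure g) y)⁻¹ ≤
      ENNReal.ofReal (1 / e) := by
    intro y
    refine ENNReal.div_le_of_le_mul ?_
    rw [gaussianPDF, ← one_mul (gaussianPDFReal 0 1 y)]
    refine ofReal_le_ofReal_mul_of_mul_le he zero_le_one ?_
    refine le_trans (le_of_eq ?_) (le_coordMarginal hg y)
    rw [← ENNReal.ofReal_mul' hc.le]
    congr 1
    simp only [e]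
    ring
  have hmeas : Measurable (Function.uncurry fun y θ => F θ y * gaussianPDF θ 1 y) :=
    (hF.comp measurable_swap).mul (measurable_gaussianPDF_prod.comp
      (g := fun p : ℝ × ℝ => gaussianPDF p.1 1 p.2) (f := Prod.swap) measurable_swap)
  calc ∫⁻ y, ∫⁻ θ, F θ y ∂(coordPosterior (densityMeasure g) y) ∂(gaussianReal 0 1)
      = ∫⁻ y, gaussianPDF 0 1 y * ((coordMarginal (densityMeasure g) y)⁻¹ *
          ∫⁻ θ, F θ y * gaussianPDF θ 1 y ∂(densityMeasure g)) := by
        rw [gaussianReal_of_var_ne_zero _ one_ne_zero, lintegral_withDensity_eq_lintegral_mul _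
          (measurable_gaussianPDF _ _) (measurable_lintegral_coordPosterior _ hF)]
        refine lintegral_congr fun y => ?_
        rw [Pi.mul_apply, lintegral_coordPosterior _ _ (hFy y)]
    _ ≤ ∫⁻ y, ENNReal.ofReal (1 / e) *
          ∫⁻ θ, F θ y * gaussianPDF θ 1 y ∂(densityMeasure g) := by
        refine lintegral_mono fun y => ?_
        rw [← mul_assoc]
        exact mul_le_mul_left (hφ y) _
    _ = ENNReal.ofReal (1 / e) *
          ∫⁻ θ, (∫⁻ y, F θ y * gaussianPDF θ 1 y) ∂(densityMeasure g) := by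
        rw [lintegral_const_mul' _ _ ENNReal.ofReal_ne_top,
          lintegral_lintegral_swap hmeas.aemeasurable]
    _ = _ := by
        congr 1
        refine lintegral_congr fun θ => ?_
        rw [gaussianReal_of_var_ne_zero _ one_ne_zero,
          lintegral_withDensity_eq_lintegral_mul _ (measurable_gaussianPDF _ _) (hFθ θ)]
        refine lintegral_congr fun y => ?_
        rw [Pi.mul_apply, mul_comm]

theorem lintegral_exp_sq_gaussianReal_lt_top :
    ∫⁻ y, ENNReal.ofReal (Real.exp (y ^ 2 / 4)) ∂(gaussianReal 0 1) < ∞ := by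
  rw [gaussianReal_of_var_ne_zero _ one_ne_zero,
    lintegral_withDensity_eq_lintegral_mul _ (measurable_gaussianPDF _ _) (by fun_prop)]
  have hint : Integrable fun y : ℝ => (√(2 * Real.pi))⁻¹ * Real.exp (-(1 / 4) * y ^ 2) :=
    (integrable_exp_neg_mul_sq (by norm_num)).const_mul _
  refine lt_of_le_of_lt (le_of_eq (lintegral_congr fun y => ?_)) hint.lintegral_lt_top
  rw [Pi.mul_apply, gaussianPDF, ← ENNReal.ofReal_mul (gaussianPDFReal_nonneg _ _ _),
    gaussianPDFReal_one, mul_assoc, ← Real.exp_add]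
  congr 3
  ring

/-- An exponential Chebyshev bound: on `T ^ 2 < y ^ 2` the factor `exp (y ^ 2 / 8 - T ^ 2 / 8)`
exceeds one, and `1 + y ^ 2 ≤ 8 * exp (y ^ 2 / 8)`. -/
theorem exists_lintegral_tail_gaussianReal_le :
    ∃ Q : ℝ, 0 ≤ Q ∧ ∀ T : ℝ, ∫⁻ y, Set.indicator {y : ℝ | T ^ 2 < y ^ 2}
      (fun y => ENNReal.ofReal (1 + y ^ 2)) y ∂(gaussianReal 0 1) ≤
        ENNReal.ofReal (Q * Real.exp (-T ^ 2 / 8)) := by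
  set E := ∫⁻ y, ENNReal.ofReal (Real.exp (y ^ 2 / 4)) ∂(gaussianReal 0 1)
  have hE : E ≠ ∞ := lintegral_exp_sq_gaussianReal_lt_top.ne
  refine ⟨8 * E.toReal, by positivity, fun T => ?_⟩
  calc ∫⁻ y, Set.indicator {y : ℝ | T ^ 2 < y ^ 2} (fun y => ENNReal.ofReal (1 + y ^ 2)) y
        ∂(gaussianReal 0 1)
      ≤ ∫⁻ y, ENNReal.ofReal (8 * Real.exp (-T ^ 2 / 8)) * ENNReal.ofReal (Real.exp (y ^ 2 / 4))
          ∂(gaussianReal 0 1) := by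
        refine lintegral_mono fun y => ?_
        simp only [Set.indicator, Set.mem_ofPred_eq]
        split_ifs with hy
        swap
        · exact zero_le
        rw [← ENNReal.ofReal_mul (by positivity), mul_assoc, ← Real.exp_add]
        refine ENNReal.ofReal_le_ofReal ?_
        have h1 : Real.exp (y ^ 2 / 8) ≤ Real.exp (-T ^ 2 / 8 + y ^ 2 / 4) :=
          Real.exp_le_exp.2 (by linarith)
        nlinarith [Real.add_one_le_exp (y ^ 2 / 8), sq_nonneg y]
    _ = ENNReal.ofReal (8 * E.toReal * Real.exp (-T ^ 2 / 8)) := by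
        rw [lintegral_const_mul' _ _ ENNReal.ofReal_ne_top,
          show 8 * E.toReal * Real.exp (-T ^ 2 / 8) = 8 * Real.exp (-T ^ 2 / 8) * E.toReal by ring,
          ENNReal.ofReal_mul (p := 8 * Real.exp (-T ^ 2 / 8)) (by positivity),
          ENNReal.ofReal_toReal hE]

/-- Bound for the expected posterior risk of a single mean whose true value is zero. -/
theorem exists_lintegral_null_le {α c A₁ A₂ B : ℝ} (hα : 0 ≤ α) (hc : 0 < c)
    (hA₁ : 0 < A₁) (hA₂ : 0 ≤ A₂) (hB : 0 ≤ B) :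
    ∃ C : ℝ, 0 ≤ C ∧ ∀ (g : ℝ → ℝ) (lam : ℝ), 0 ≤ lam → IsScaledPrior g lam α c A₁ A₂ B →
      ∀ (f : ℝ → ℝ) (a b T u v w : ℝ), 0 < a → 0 < b → 0 ≤ u → 0 ≤ v → 0 ≤ w →
        (∀ θ, f θ ≤ u + Set.indicator {θ | a < |θ|} (fun _ => v) θ +
          Set.indicator {θ | b < |θ|} (fun θ => w * θ ^ 2) θ) →
        ∫⁻ y, ∫⁻ θ, ENNReal.ofReal (f θ) ∂(coordPosterior (densityMeasure g) y)
          ∂(gaussianReal 0 1) ≤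
        ENNReal.ofReal (u + v * (C * (lam * a ^ (1 - α))) +
          w * (C * ((1 + T ^ 2) * (lam * b ^ (1 - α)) + Real.exp (-T ^ 2 / 8)))) := by
  obtain ⟨C₂, hC₂, hsq⟩ := exists_lintegral_sq_coordPosterior_le B hα hc hA₁ hA₂
  obtain ⟨Q, hQ, htail⟩ := exists_lintegral_tail_gaussianReal_le
  set D := 1 / (Real.exp (-1 / 2) * c)
  have hD : 0 ≤ D := by positivity
  refine ⟨2 * (D * B) + C₂ * Q, by positivity, ?_⟩
  intro g lam hlam hg f a b T u v w ha hb hu hv hw hf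
  have := hg.isProbabilityMeasure
  have hset : ∀ r : ℝ, MeasurableSet {θ : ℝ | r < |θ|} := fun r =>
    measurableSet_lt measurable_const (by fun_prop)
  have hmass : ∀ r, 0 < r → densityMeasure g {θ | r < |θ|} ≤
      ENNReal.ofReal (B * lam * r ^ (1 - α)) := fun r hr => by
    rw [densityMeasure, withDensity_apply _ (hset r)]
    exact hg.tail r hr
  set F₁ : ℝ → ℝ → ℝ≥0∞ := fun θ _ => Set.indicator {θ | a < |θ|} (fun _ => 1) θ
  -- Truncating the data replaces a possibly infinite prior second moment: when `y ^ 2 ≤ T ^ 2`, `θ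
  -- ^ 2 ≤ 2 * T ^ 2 + 2 * (y - θ) ^ 2`, whose mean under `N(θ, 1)` does not depend on `θ`.
  set F₂ : ℝ → ℝ → ℝ≥0∞ := fun θ y => Set.indicator {θ | b < |θ|} (fun _ => 1) θ *
    (ENNReal.ofReal (θ ^ 2) * Set.indicator {y : ℝ | y ^ 2 ≤ T ^ 2} (fun _ => 1) y)
  have hsT : MeasurableSet {y : ℝ | y ^ 2 ≤ T ^ 2} :=
    measurableSet_le (by fun_prop) measurable_const
  have hF₁ : Measurable (Function.uncurry F₁) :=
    (measurable_const.indicator (hset a)).comp measurable_fst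
  have hF₂ : Measurable (Function.uncurry F₂) :=
    ((measurable_const.indicator (hset b)).comp measurable_fst).mul
      ((by fun_prop : Measurable fun p : ℝ × ℝ => ENNReal.ofReal (p.1 ^ 2)).mul
        ((measurable_const.indicator hsT).comp measurable_snd))
  have hF₂y : ∀ y, Measurable fun θ => F₂ θ y := fun y => hF₂.comp measurable_prodMk_right
  have hI₁ : ∫⁻ y, ∫⁻ θ, F₁ θ y ∂(coordPosterior (densityMeasure g) y) ∂(gaussianReal 0 1) ≤
      ENNReal.ofReal (D * B * (lam * a ^ (1 - α))) := by
    refine (lintegral_coordPosterior_null_le hc hg hF₁).trans ?_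
    simp only [F₁, lintegral_const, measure_univ, mul_one]
    rw [lintegral_indicator_const (hset a), one_mul, mul_assoc, ENNReal.ofReal_mul hD]
    refine mul_le_mul_right ((hmass a ha).trans (le_of_eq ?_)) _
    rw [mul_assoc]
  have hI₂ : ∫⁻ y, ∫⁻ θ, F₂ θ y ∂(coordPosterior (densityMeasure g) y) ∂(gaussianReal 0 1) ≤
      ENNReal.ofReal (2 * (D * B) * ((1 + T ^ 2) * (lam * b ^ (1 - α)))) := by
    refine (lintegral_coordPosterior_null_le hc hg hF₂).trans ?_
    have hin : ∀ θ, ∫⁻ y, F₂ θ y ∂(gaussianReal θ 1) ≤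
        Set.indicator {θ | b < |θ|} (fun _ => ENNReal.ofReal (2 * (1 + T ^ 2))) θ := by
      intro θ
      simp only [F₂]
      by_cases hθ : θ ∈ {θ : ℝ | b < |θ|}
      · rw [Set.indicator_of_mem hθ, Set.indicator_of_mem hθ]
        calc ∫⁻ y, 1 * (ENNReal.ofReal (θ ^ 2) *
              Set.indicator {y : ℝ | y ^ 2 ≤ T ^ 2} (fun _ => 1) y) ∂(gaussianReal θ 1)
            ≤ ∫⁻ y, (ENNReal.ofReal (2 * T ^ 2) + ENNReal.ofReal 2 * ENNReal.ofReal ((y - θ) ^ 2))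
                ∂(gaussianReal θ 1) := by
              refine lintegral_mono fun y => ?_
              rw [one_mul, ← ENNReal.ofReal_mul zero_le_two,
                ← ENNReal.ofReal_add (by positivity) (by positivity)]
              by_cases hy : y ∈ {y : ℝ | y ^ 2 ≤ T ^ 2}
              · rw [Set.indicator_of_mem hy, mul_one]
                refine ENNReal.ofReal_le_ofReal ?_
                have hy' : y ^ 2 ≤ T ^ 2 := hy
                nlinarith [sq_nonneg (θ - 2 * y)]
              · rw [Set.indicator_of_notMem hy, mul_zero]
                exact zero_le
          _ = ENNReal.ofReal (2 * (1 + T ^ 2)) := by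
              rw [lintegral_add_left measurable_const,
                lintegral_const_mul' _ _ ENNReal.ofReal_ne_top, lintegral_sq_sub_gaussianReal,
                lintegral_const, measure_univ, mul_one, mul_one,
                ← ENNReal.ofReal_add (by positivity) zero_le_two]
              congr 1
              ring
      · simp [Set.indicator_of_notMem hθ]
    refine (mul_le_mul_right (lintegral_mono hin) _).trans ?_
    rw [lintegral_indicator_const (hset b)]
    refine (mul_le_mul_right (mul_le_mul_right (hmass b hb) _) _).trans (le_of_eq ?_)
    rw [← ENNReal.ofReal_mul (by positivity), ← ENNReal.ofReal_mul hD]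
    congr 1
    ring
  have hI₃ : ∫⁻ y, Set.indicator {y : ℝ | T ^ 2 < y ^ 2}
      (fun y => ENNReal.ofReal (C₂ * (1 + y ^ 2))) y ∂(gaussianReal 0 1) ≤
      ENNReal.ofReal (C₂ * Q * Real.exp (-T ^ 2 / 8)) := by
    have : ∀ y, Set.indicator {y : ℝ | T ^ 2 < y ^ 2}
        (fun y => ENNReal.ofReal (C₂ * (1 + y ^ 2))) y = ENNReal.ofReal C₂ *
          Set.indicator {y : ℝ | T ^ 2 < y ^ 2} (fun y => ENNReal.ofReal (1 + y ^ 2)) y := by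
      intro y
      simp only [Set.indicator, ENNReal.ofReal_mul hC₂, mul_ite, mul_zero]
    simp_rw [this]
    rw [lintegral_const_mul' _ _ ENNReal.ofReal_ne_top, mul_assoc, ENNReal.ofReal_mul hC₂]
    exact mul_le_mul_right (htail T) _
  have hpt : ∀ y, ∫⁻ θ, ENNReal.ofReal (f θ) ∂(coordPosterior (densityMeasure g) y) ≤
      ENNReal.ofReal u + (ENNReal.ofReal v * ∫⁻ θ, F₁ θ y ∂(coordPosterior (densityMeasure g) y) +
        ENNReal.ofReal w * (∫⁻ θ, F₂ θ y ∂(coordPosterior (densityMeasure g) y) +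
          Set.indicator {y : ℝ | T ^ 2 < y ^ 2}
            (fun y => ENNReal.ofReal (C₂ * (1 + y ^ 2))) y)) := by
    intro y
    calc ∫⁻ θ, ENNReal.ofReal (f θ) ∂(coordPosterior (densityMeasure g) y)
        ≤ ∫⁻ θ, (ENNReal.ofReal u + (ENNReal.ofReal v * F₁ θ y + ENNReal.ofReal w *
            (F₂ θ y + Set.indicator {y : ℝ | T ^ 2 < y ^ 2} (fun _ => 1) y *
              ENNReal.ofReal (θ ^ 2)))) ∂(coordPosterior (densityMeasure g) y) := by
          refine lintegral_mono fun θ => (ENNReal.ofReal_le_ofReal (hf θ)).trans ?_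
          rw [add_assoc]
          refine ENNReal.ofReal_add_le.trans (add_le_add le_rfl
            (ENNReal.ofReal_add_le.trans (add_le_add ?_ ?_)))
          · simp only [F₁, Set.indicator]
            split_ifs <;> simp
          · rcases le_or_gt (y ^ 2) (T ^ 2) with hy | hy
            · have hy' := hy.not_gt
              simp only [F₂, Set.indicator, Set.mem_ofPred_eq, hy, hy', if_true, if_false]
              split_ifs <;> simp [ENNReal.ofReal_mul hw]
            · have hy' := hy.not_ge
              simp only [F₂, Set.indicator, Set.mem_ofPred_eq, hy, hy', if_true, if_false]
              split_ifs <;> simp [ENNReal.ofReal_mul hw]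
      _ = ENNReal.ofReal u + (ENNReal.ofReal v *
            ∫⁻ θ, F₁ θ y ∂(coordPosterior (densityMeasure g) y) +
          ENNReal.ofReal w * (∫⁻ θ, F₂ θ y ∂(coordPosterior (densityMeasure g) y) +
            Set.indicator {y : ℝ | T ^ 2 < y ^ 2} (fun _ => 1) y *
              ∫⁻ θ, ENNReal.ofReal (θ ^ 2) ∂(coordPosterior (densityMeasure g) y))) := by
          have hm₁ : Measurable fun θ => F₁ θ y := measurable_const.indicator (hset a)
          have hm₃ : Measurable fun θ : ℝ => ENNReal.ofReal (θ ^ 2) := by fun_prop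
          rw [lintegral_add_left measurable_const, lintegral_add_left (hm₁.const_mul _),
            lintegral_const_mul' _ _ ENNReal.ofReal_ne_top,
            lintegral_const_mul' _ _ ENNReal.ofReal_ne_top, lintegral_add_left (hF₂y y),
            lintegral_const_mul _ hm₃, lintegral_const, measure_univ, mul_one]
      _ ≤ _ := by
          gcongr
          by_cases hy : y ∈ {y : ℝ | T ^ 2 < y ^ 2}
          · rw [Set.indicator_of_mem hy, Set.indicator_of_mem hy, one_mul]
            exact hsq g lam hlam hg y
          · rw [Set.indicator_of_notMem hy, zero_mul]
            exact zero_le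
  calc ∫⁻ y, ∫⁻ θ, ENNReal.ofReal (f θ) ∂(coordPosterior (densityMeasure g) y) ∂(gaussianReal 0 1)
      ≤ ENNReal.ofReal u + (ENNReal.ofReal v *
          ∫⁻ y, ∫⁻ θ, F₁ θ y ∂(coordPosterior (densityMeasure g) y) ∂(gaussianReal 0 1) +
        ENNReal.ofReal w *
          (∫⁻ y, ∫⁻ θ, F₂ θ y ∂(coordPosterior (densityMeasure g) y) ∂(gaussianReal 0 1) +
          ∫⁻ y, Set.indicator {y : ℝ | T ^ 2 < y ^ 2}
            (fun y => ENNReal.ofReal (C₂ * (1 + y ^ 2))) y ∂(gaussianReal 0 1))) := by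
        refine (lintegral_mono hpt).trans (le_of_eq ?_)
        have hm₁ := measurable_lintegral_coordPosterior (densityMeasure g) hF₁
        have hm₂ := measurable_lintegral_coordPosterior (densityMeasure g) hF₂
        rw [lintegral_add_left measurable_const, lintegral_add_left (hm₁.const_mul _),
          lintegral_const_mul' _ _ ENNReal.ofReal_ne_top,
          lintegral_const_mul' _ _ ENNReal.ofReal_ne_top, lintegral_add_left hm₂,
          lintegral_const, measure_univ, mul_one]
    _ ≤ ENNReal.ofReal u + (ENNReal.ofReal v * ENNReal.ofReal (D * B * (lam * a ^ (1 - α))) +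
        ENNReal.ofReal w * (ENNReal.ofReal (2 * (D * B) * ((1 + T ^ 2) * (lam * b ^ (1 - α)))) +
          ENNReal.ofReal (C₂ * Q * Real.exp (-T ^ 2 / 8)))) := by gcongr
    _ ≤ _ := by
        have hl : ∀ r : ℝ, 0 < r → 0 ≤ lam * r ^ (1 - α) := fun r hr => by positivity
        have h1 := hl a ha
        have h2 := hl b hb
        have hDB : 0 ≤ D * B := by positivity
        have hCQ : 0 ≤ C₂ * Q := by positivity
        rw [← ENNReal.ofReal_add (by positivity) (by positivity), ← ENNReal.ofReal_mul hv,
          ← ENNReal.ofReal_mul hw, ← ENNReal.ofReal_add (by positivity) (by positivity),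
          ← ENNReal.ofReal_add (by positivity) (by positivity), ← add_assoc]
        refine ENNReal.ofReal_le_ofReal ?_
        gcongr
        · linarith
        · rw [mul_add]
          gcongr <;> linarith

/-! ### Rescaled polynomial-tail priors -/

theorem lintegral_comp_div_real {τ : ℝ} (hτ : 0 < τ) {f : ℝ → ℝ≥0∞} (hf : Measurable f) :
    ∫⁻ t, f (t / τ) = ENNReal.ofReal τ * ∫⁻ t, f t := by
  have h := lintegral_map (μ := volume) hf (measurable_const_mul τ⁻¹)
  rw [Real.map_volume_mul_left (inv_ne_zero hτ.ne'), inv_inv, abs_of_pos hτ,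
    lintegral_smul_measure, smul_eq_mul] at h
  rw [h]
  simp_rw [div_eq_inv_mul]

theorem lintegral_rpow_neg_Ioi {α r C : ℝ} (hα : 1 < α) (hr : 0 < r) (hC : 0 ≤ C) :
    ∫⁻ u in Set.Ioi r, ENNReal.ofReal (C * u ^ (-α)) =
      ENNReal.ofReal (C / (α - 1) * r ^ (1 - α)) := by
  rw [← ofReal_integral_eq_lintegral_ofReal]
  · rw [integral_const_mul, integral_Ioi_rpow_of_lt (by linarith) hr]
    congr 1
    rw [show -α + 1 = -(α - 1) by ring, show 1 - α = -(α - 1) by ring, neg_div_neg_eq]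
    ring
  · exact (integrableOn_Ioi_rpow_of_lt (by linarith) hr).const_mul C
  · refine (ae_restrict_iff' measurableSet_Ioi).2 (Eventually.of_forall fun u hu => ?_)
    have : 0 < u := hr.trans hu
    positivity

theorem lintegral_abs_rpow_neg {α r C : ℝ} (hα : 1 < α) (hr : 0 < r) (hC : 0 ≤ C) :
    ∫⁻ u in {u : ℝ | r < |u|}, ENNReal.ofReal (C * |u| ^ (-α)) ≤
      ENNReal.ofReal (2 * C / (α - 1) * r ^ (1 - α)) := by
  have hset : {u : ℝ | r < |u|} = Set.Ioi r ∪ Set.Iio (-r) := by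
    ext u
    simp only [Set.mem_ofPred_eq, lt_abs, Set.mem_union, Set.mem_Ioi, Set.mem_Iio]
    constructor <;> rintro (h | h) <;> first | exact Or.inl h | exact Or.inr (by linarith)
  have hpos : ∫⁻ u in Set.Ioi r, ENNReal.ofReal (C * |u| ^ (-α)) =
      ENNReal.ofReal (C / (α - 1) * r ^ (1 - α)) := by
    rw [← lintegral_rpow_neg_Ioi hα hr hC]
    refine setLIntegral_congr_fun measurableSet_Ioi fun u hu => ?_
    simp only [abs_of_pos (hr.trans hu)]
  have hneg : ∫⁻ u in Set.Iio (-r), ENNReal.ofReal (C * |u| ^ (-α)) =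
      ∫⁻ u in Set.Ioi r, ENNReal.ofReal (C * |u| ^ (-α)) := by
    rw [← lintegral_indicator measurableSet_Iio, ← lintegral_indicator measurableSet_Ioi,
      ← lintegral_comp_neg_real (Measurable.indicator (by fun_prop) measurableSet_Iio)]
    refine lintegral_congr fun u => ?_
    simp [Set.indicator]
  rw [hset]
  refine (lintegral_union_le _ _ _).trans (le_of_eq ?_)
  have : 0 ≤ C / (α - 1) * r ^ (1 - α) :=
    mul_nonneg (div_nonneg hC (by linarith)) (Real.rpow_nonneg hr.le _)
  rw [hneg, hpos, ← ENNReal.ofReal_add this this]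
  congr 1
  ring

/-- For `r ≥ M` the tail bound is integrated; for `r < M` the total mass one is at most `(M / r) ^
(α - 1)`. -/
theorem IsPolynomialTailPrior.exists_tail_le {p₀ : ℝ → ℝ} {α : ℝ} (hα : 1 < α)
    (hp : IsPolynomialTailPrior p₀ α) :
    ∃ B : ℝ, 0 ≤ B ∧ ∀ r, 0 < r →
      ∫⁻ u in {u : ℝ | r < |u|}, ENNReal.ofReal (p₀ u) ≤ ENNReal.ofReal (B * r ^ (1 - α)) := by
  obtain ⟨M, c₁, c₂, hM, hc₁, hc₂, htail⟩ := hp.tail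
  have hc : 0 < c₂ := hc₁.trans hc₂
  have hα' : 0 < α - 1 := by linarith
  refine ⟨2 * c₂ / (α - 1) + M ^ (α - 1), by positivity, fun r hr => ?_⟩
  have hm : MeasurableSet {u : ℝ | r < |u|} := measurableSet_lt measurable_const (by fun_prop)
  rw [add_mul, ENNReal.ofReal_add (by positivity) (by positivity)]
  rcases le_or_gt M r with hMr | hMr
  · refine le_trans (le_trans (setLIntegral_mono' hm fun u hu => ?_)
      (lintegral_abs_rpow_neg hα hr hc.le)) le_self_add
    exact ENNReal.ofReal_le_ofReal (htail u (hMr.trans_lt hu)).2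
  · refine le_trans ((setLIntegral_le_lintegral _ _).trans
      (hp.lintegral_eq_one.trans_le ?_)) le_add_self
    rw [← ENNReal.ofReal_one]
    refine ENNReal.ofReal_le_ofReal ?_
    rw [show 1 - α = -(α - 1) by ring, Real.rpow_neg hr.le, ← div_eq_mul_inv,
      one_le_div (by positivity)]
    exact Real.rpow_le_rpow hr.le hMr.le hα'.le

/-- This is where the parameter `lam = τ ^ (α - 1)` of the rescaled tail comes from. -/
theorem inv_mul_abs_div_rpow_neg {τ : ℝ} (hτ : 0 < τ) (α C θ : ℝ) :
    1 / τ * (C * |θ / τ| ^ (-α)) = C * τ ^ (α - 1) * |θ| ^ (-α) := by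
  rw [abs_div, abs_of_pos hτ, Real.div_rpow (abs_nonneg θ) hτ.le, Real.rpow_sub_one hτ.ne',
    Real.rpow_neg hτ.le]
  have : τ ^ α ≠ 0 := (Real.rpow_pos_of_pos hτ α).ne'
  field_simp

/-- For small scales, the rescaled prior satisfies the estimates of `IsScaledPrior` with constants
not depending on the scale. -/
theorem IsPolynomialTailPrior.exists_isScaledPrior {p₀ : ℝ → ℝ} {α : ℝ} (hα : 1 < α)
    (hp : IsPolynomialTailPrior p₀ α) :
    ∃ c A₁ A₂ B τ₀ : ℝ, 0 < c ∧ 0 < A₁ ∧ 0 < A₂ ∧ 0 ≤ B ∧ 0 < τ₀ ∧ ∀ τ, 0 < τ → τ ≤ τ₀ →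
      IsScaledPrior (fun t => (1 / τ) * p₀ (t / τ)) (τ ^ (α - 1)) α c A₁ A₂ B := by
  obtain ⟨B, hB, hBtail⟩ := hp.exists_tail_le hα
  obtain ⟨M, c₁, c₂, hM, hc₁, hc₂, htail⟩ := hp.tail
  -- The mass near zero is taken from `M * τ < |θ| ≤ 4 * M * τ`, of length `3 * M * τ` on each side,
  -- where the density is at least `c₁ * (4 * M) ^ (-α) / τ`. The condition `τ ≤ 1 / (4 * M)` keeps
  -- this inside the unit interval and puts `|θ| ≥ 1 / 2` in the tail region.
  refine ⟨3 * M * (c₁ * (4 * M) ^ (-α)), c₁, c₂, B, 1 / (4 * M), by positivity, hc₁,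
    hc₁.trans hc₂, hB, by positivity, fun τ hτ hτ₀ => ?_⟩
  have hτM : 4 * M * τ ≤ 1 := by
    rw [le_div_iff₀ (by positivity)] at hτ₀
    linarith
  have hfar : ∀ θ : ℝ, 1 / 2 ≤ |θ| → M < |θ / τ| := fun θ hθ => by
    rw [abs_div, abs_of_pos hτ, lt_div_iff₀ hτ]
    nlinarith
  have hmid : ∀ θ : ℝ, M * τ < |θ| → |θ| ≤ 4 * M * τ →
      1 / τ * (c₁ * (4 * M) ^ (-α)) ≤ 1 / τ * p₀ (θ / τ) := fun θ h1 h2 => by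
    have h3 : |θ / τ| = |θ| / τ := by rw [abs_div, abs_of_pos hτ]
    have h4 : M < |θ / τ| := by rwa [h3, lt_div_iff₀ hτ]
    refine mul_le_mul_of_nonneg_left (le_trans ?_ (htail _ h4).1) (by positivity)
    refine mul_le_mul_of_nonneg_left ?_ hc₁.le
    refine Real.rpow_le_rpow_of_nonpos (hM.trans h4) ?_ (by linarith)
    rwa [h3, div_le_iff₀ hτ]
  have hlen : ENNReal.ofReal (3 * M * (c₁ * (4 * M) ^ (-α))) =
      ENNReal.ofReal (1 / τ * (c₁ * (4 * M) ^ (-α))) * ENNReal.ofReal (4 * M * τ - M * τ) := by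
    rw [← ENNReal.ofReal_mul (by positivity)]
    congr 1
    field_simp
    ring
  have hMτ : 0 < M * τ := by positivity
  have hmeas : Measurable fun t => ENNReal.ofReal (p₀ t) := hp.measurable.ennreal_ofReal
  have hscale : ENNReal.ofReal (1 / τ) * ENNReal.ofReal τ = 1 := by
    rw [← ENNReal.ofReal_mul (by positivity), one_div_mul_cancel hτ.ne', ENNReal.ofReal_one]
  refine ⟨?_, ?_, ?_, ?_, ?_, ?_, ?_, ?_, ?_, ?_⟩
  · exact (hp.measurable.comp (measurable_id.div_const τ)).const_mul _
  · exact fun θ => mul_nonneg (by positivity) (hp.nonneg _)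
  · simp_rw [ENNReal.ofReal_mul (show 0 ≤ 1 / τ by positivity)]
    rw [lintegral_const_mul' _ _ ENNReal.ofReal_ne_top,
      lintegral_comp_div_real hτ hmeas, hp.lintegral_eq_one, mul_one, hscale]
  · intro x hx y hy hxy
    refine mul_le_mul_of_nonneg_left ?_ (by positivity)
    exact hp.strictAntiOn.antitoneOn (div_pos hx hτ) (div_pos hy hτ)
      (div_le_div_of_nonneg_right hxy hτ.le)
  · intro x hx y hy hxy
    refine mul_le_mul_of_nonneg_left ?_ (by positivity)
    exact hp.monotoneOn (div_neg_of_neg_of_pos hx hτ) (div_neg_of_neg_of_pos hy hτ)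
      (div_le_div_of_nonneg_right hxy hτ.le)
  · rw [hlen, ← Real.volume_Ioc, ← setLIntegral_const]
    refine (setLIntegral_mono' measurableSet_Ioc fun θ hθ => ENNReal.ofReal_le_ofReal
      (hmid θ ?_ ?_)).trans (lintegral_mono_set fun θ hθ => ⟨hMτ.trans hθ.1, hθ.2.trans hτM⟩)
    · rw [abs_of_pos (hMτ.trans hθ.1)]; exact hθ.1
    · rw [abs_of_pos (hMτ.trans hθ.1)]; exact hθ.2
  · rw [hlen, show 4 * M * τ - M * τ = -(M * τ) - -(4 * M * τ) by ring, ← Real.volume_Ico,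
      ← setLIntegral_const]
    refine (setLIntegral_mono' measurableSet_Ico fun θ hθ => ENNReal.ofReal_le_ofReal
      (hmid θ ?_ ?_)).trans (lintegral_mono_set fun θ hθ =>
        ⟨by linarith [hθ.1], hθ.2.trans (neg_lt_zero.2 hMτ)⟩)
    · rw [abs_of_neg (hθ.2.trans (neg_lt_zero.2 hMτ))]; linarith [hθ.2]
    · rw [abs_of_neg (hθ.2.trans (neg_lt_zero.2 hMτ))]; linarith [hθ.1]
  · intro θ hθ
    rw [← inv_mul_abs_div_rpow_neg hτ]
    exact mul_le_mul_of_nonneg_left (htail _ (hfar θ hθ)).1 (by positivity)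
  · intro θ hθ
    rw [← inv_mul_abs_div_rpow_neg hτ]
    exact mul_le_mul_of_nonneg_left (htail _ (hfar θ hθ)).2 (by positivity)
  · intro r hr
    have hset : ∀ r : ℝ, MeasurableSet {θ : ℝ | r < |θ|} := fun r =>
      measurableSet_lt measurable_const (by fun_prop)
    have hind : ∀ θ, Set.indicator {θ : ℝ | r < |θ|}
        (fun θ => ENNReal.ofReal (1 / τ * p₀ (θ / τ))) θ = ENNReal.ofReal (1 / τ) *
          Set.indicator {θ : ℝ | r / τ < |θ|} (fun θ => ENNReal.ofReal (p₀ θ)) (θ / τ) := by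
      intro θ
      have : r / τ < |θ / τ| ↔ r < |θ| := by
        rw [abs_div, abs_of_pos hτ, div_lt_div_iff_of_pos_right hτ]
      simp only [Set.indicator, Set.mem_ofPred_eq, this]
      rw [ENNReal.ofReal_mul (by positivity), mul_ite, mul_zero]
    rw [← lintegral_indicator (hset r)]
    simp_rw [hind]
    rw [lintegral_const_mul' _ _ ENNReal.ofReal_ne_top,
      lintegral_comp_div_real hτ (hmeas.indicator (hset _)), ← mul_assoc, hscale, one_mul,
      lintegral_indicator (hset _)]
    refine (hBtail _ (by positivity)).trans (le_of_eq ?_)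
    congr 1
    rw [Real.div_rpow hr.le hτ.le, show 1 - α = -(α - 1) by ring, Real.rpow_neg hτ.le (α - 1),
      div_inv_eq_mul]
    ring

/-! ### Bounds in a fixed dimension -/

/-- The contribution of one coordinate, with true mean `x`, to the loss: the excess of the squared
deviation from the observation plus the squared noise on the support, and `h` off the support. -/
def coordLoss (h : ℝ → ℝ) (t x θ y : ℝ) : ℝ :=
  if x ≠ 0 then max ((θ - y) ^ 2 - t ^ 2) 0 + (y - x) ^ 2 else h θ

theorem sum_support_const {n s : ℕ} {θ' : Fin n → ℝ} (hs : Set.ncard {i | θ' i ≠ 0} = s) (C : ℝ) :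
    ∑ i, (if θ' i ≠ 0 then C else 0) = s * C := by
  rw [← Finset.sum_filter, Finset.sum_const, nsmul_eq_mul, ← hs, Set.ncard_eq_toFinset_card']
  simp

/-- On the support, go through `y`: `|x| ≤ t + max (x ^ 2 - t ^ 2) 0` because `t ≥ 1`, and the noise
obeys `|z| ≤ 1 + z ^ 2`. The deterministic cost is `t + 1` per nonzero mean. -/
theorem le_sum_coordLoss_of_le_norm_one {n s : ℕ} {θ' : Fin n → ℝ}
    (hs : Set.ncard {i | θ' i ≠ 0} = s) {t r K : ℝ} (ht : 1 ≤ t) (hr : s * (t + 1) + K ≤ r)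
    (θ y : Fin n → ℝ) (hle : r ≤ ‖WithLp.toLp 1 (θ - θ')‖) :
    K ≤ ∑ i, coordLoss (fun θ => |θ|) t (θ' i) (θ i) (y i) := by
  have hnorm : ‖WithLp.toLp 1 (θ - θ')‖ = ∑ i, |θ i - θ' i| := by
    simp [PiLp.norm_eq_of_L1]
  have hsum : ∑ i, |θ i - θ' i| ≤ ∑ i, ((if θ' i ≠ 0 then t + 1 else 0) +
      coordLoss (fun θ => |θ|) t (θ' i) (θ i) (y i)) := by
    refine Finset.sum_le_sum fun i _ => ?_
    unfold coordLoss
    split_ifs with h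
    · have h1 : |θ i - θ' i| ≤ |θ i - y i| + |y i - θ' i| := abs_sub_le _ _ _
      have h2 : |y i - θ' i| ≤ 1 + (y i - θ' i) ^ 2 := by
        rw [← sq_abs]; nlinarith [sq_nonneg (|y i - θ' i| - 1)]
      have h3 : |θ i - y i| ≤ t + max ((θ i - y i) ^ 2 - t ^ 2) 0 := by
        rcases le_total |θ i - y i| t with h4 | h4
        · linarith [le_max_right ((θ i - y i) ^ 2 - t ^ 2) 0]
        · have := le_max_left ((θ i - y i) ^ 2 - t ^ 2) 0
          rw [← sq_abs] at this ⊢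
          nlinarith
      linarith
    · push Not at h
      simp [h]
  rw [Finset.sum_add_distrib, sum_support_const hs] at hsum
  linarith

/-- The error splits into deviation from the data on the support, noise on the support, and the part
off the support. If the total loss is below `κ ^ 2`, the norms are below `√s * t + κ`, `κ` and `κ`,
whence the `3 * κ`. -/
theorem le_sum_coordLoss_of_le_norm_two {n s : ℕ} {θ' : Fin n → ℝ}
    (hs : Set.ncard {i | θ' i ≠ 0} = s) {t r κ : ℝ} (ht : 0 ≤ t) (hκ : 0 ≤ κ)
    (hr : √s * t + 3 * κ ≤ r) (θ y : Fin n → ℝ) (hle : r ≤ ‖WithLp.toLp 2 (θ - θ')‖) :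
    κ ^ 2 ≤ ∑ i, coordLoss (fun θ => θ ^ 2) t (θ' i) (θ i) (y i) := by
  by_contra hcon
  push Not at hcon
  set Z := ∑ i, coordLoss (fun θ => θ ^ 2) t (θ' i) (θ i) (y i)
  have hZ0 : 0 ≤ Z := Finset.sum_nonneg fun i _ => by
    unfold coordLoss
    split_ifs <;> positivity
  have hZ : √Z < κ := by
    rcases hκ.eq_or_lt with rfl | hκ'
    · nlinarith
    · rw [Real.sqrt_lt' hκ']; exact hcon
  let u : EuclideanSpace ℝ (Fin n) :=
    WithLp.toLp 2 fun i => if θ' i ≠ 0 then θ i - y i else 0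
  let v : EuclideanSpace ℝ (Fin n) :=
    WithLp.toLp 2 fun i => if θ' i ≠ 0 then y i - θ' i else 0
  let w : EuclideanSpace ℝ (Fin n) := WithLp.toLp 2 fun i => if θ' i ≠ 0 then 0 else θ i
  have hdecomp : WithLp.toLp 2 (θ - θ') = u + v + w := by
    ext i
    simp only [u, v, w, PiLp.add_apply, Pi.sub_apply]
    split_ifs with h
    · ring
    · push Not at h
      simp [h]
  have hsub : ∀ f : Fin n → ℝ, (∀ i, f i ^ 2 ≤ coordLoss (fun θ => θ ^ 2) t (θ' i) (θ i) (y i)) →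
      ‖(WithLp.toLp 2 f : EuclideanSpace ℝ (Fin n))‖ ≤ √Z := fun f hf => by
    rw [EuclideanSpace.norm_eq]
    refine Real.sqrt_le_sqrt (Finset.sum_le_sum fun i _ => ?_)
    simpa using hf i
  have hv : ‖v‖ ≤ √Z := hsub _ fun i => by
    unfold coordLoss
    split_ifs
    · linarith [le_max_right ((θ i - y i) ^ 2 - t ^ 2) 0]
    · nlinarith [sq_nonneg (θ i)]
  have hw : ‖w‖ ≤ √Z := hsub _ fun i => by
    unfold coordLoss
    split_ifs
    · nlinarith [le_max_right ((θ i - y i) ^ 2 - t ^ 2) 0, sq_nonneg (y i - θ' i)]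
    · exact le_rfl
  have hu : ‖u‖ ≤ √s * t + √Z := by
    have h1 : ‖u‖ ≤ √(s * t ^ 2 + Z) := by
      rw [EuclideanSpace.norm_eq, ← sum_support_const hs, ← Finset.sum_add_distrib]
      refine Real.sqrt_le_sqrt (Finset.sum_le_sum fun i _ => ?_)
      simp only [u, Real.norm_eq_abs, sq_abs, coordLoss]
      split_ifs
      · linarith [le_max_left ((θ i - y i) ^ 2 - t ^ 2) 0, sq_nonneg (y i - θ' i)]
      · nlinarith [sq_nonneg (θ i)]
    refine h1.trans (Real.sqrt_le_iff.2 ⟨by positivity, ?_⟩)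
    have hs0 : 0 ≤ √(s : ℝ) * t * √Z := by positivity
    nlinarith [Real.sq_sqrt hZ0, Real.sq_sqrt (Nat.cast_nonneg (α := ℝ) s)]
  have := norm_add₃_le (a := u) (b := v) (c := w)
  rw [hdecomp] at hle
  linarith

/-- Each nonzero mean costs `C` for the excess plus `1` for the noise variance; the null cost `N` is
charged to all `n` coordinates, which only enlarges the bound. -/
theorem expectedPosteriorMassOutside_le_of_coordLoss {q : ℝ≥0∞} [Fact (1 ≤ q)] {p₀ : ℝ → ℝ}
    {τ : ℝ} [IsProbabilityMeasure (coordPrior p₀ τ)] {n s : ℕ} {θ' : Fin n → ℝ}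
    (hs : Set.ncard {i | θ' i ≠ 0} = s) {r t C N K : ℝ} {h : ℝ → ℝ} (hh : Measurable h)
    (hC : 0 ≤ C) (hN : 0 ≤ N) (hK : 0 < K)
    (hsig : ∀ y, ∫⁻ θ, ENNReal.ofReal ((θ - y) ^ 2 - t ^ 2) ∂(coordPosterior (coordPrior p₀ τ) y) ≤
      ENNReal.ofReal C)
    (hnull : ∫⁻ y, ∫⁻ θ, ENNReal.ofReal (h θ) ∂(coordPosterior (coordPrior p₀ τ) y)
      ∂(gaussianReal 0 1) ≤ ENNReal.ofReal N)
    (hev : ∀ θ y : Fin n → ℝ, r ≤ ‖WithLp.toLp q (θ - θ')‖ →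
      K ≤ ∑ i, coordLoss h t (θ' i) (θ i) (y i)) :
    expectedPosteriorMassOutside q p₀ τ θ' r ≤ ENNReal.ofReal ((s * (C + 1) + n * N) / K) := by
  have hF : ∀ i, Measurable (Function.uncurry fun θ y =>
      ENNReal.ofReal (coordLoss h t (θ' i) θ y)) := fun i => by
    unfold coordLoss
    split_ifs
    · exact Measurable.ennreal_ofReal (by fun_prop)
    · exact (hh.comp measurable_fst).ennreal_ofReal
  refine (expectedPosteriorMassOutside_le θ' hF (K := ENNReal.ofReal K)
    (ENNReal.ofReal_pos.2 hK).ne' ENNReal.ofReal_ne_top fun θ y hle => ?_).trans ?_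
  · refine (ENNReal.ofReal_le_ofReal (hev θ y hle)).trans ?_
    exact Finset.le_sum_of_subadditive _ ENNReal.ofReal_zero.le
      (fun _ _ => ENNReal.ofReal_add_le) _ _
  have hcoord : ∀ i, ∫⁻ y, ∫⁻ θ, ENNReal.ofReal (coordLoss h t (θ' i) θ y)
      ∂(coordPosterior (coordPrior p₀ τ) y) ∂(gaussianReal (θ' i) 1) ≤
      ENNReal.ofReal ((if θ' i ≠ 0 then C + 1 else 0) + N) := by
    intro i
    by_cases hi : θ' i ≠ 0
    · simp only [coordLoss, if_pos hi]
      calc ∫⁻ y, ∫⁻ θ, ENNReal.ofReal (max ((θ - y) ^ 2 - t ^ 2) 0 + (y - θ' i) ^ 2)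
            ∂(coordPosterior (coordPrior p₀ τ) y) ∂(gaussianReal (θ' i) 1)
          ≤ ∫⁻ y, (ENNReal.ofReal C + ENNReal.ofReal ((y - θ' i) ^ 2))
              ∂(gaussianReal (θ' i) 1) := by
            refine lintegral_mono fun y => ?_
            refine le_trans (le_of_eq ?_) (add_le_add (hsig y) le_rfl)
            simp_rw [ENNReal.ofReal_add (le_max_right _ (0 : ℝ)) (sq_nonneg (y - θ' i)),
              ENNReal.ofReal_max, ENNReal.ofReal_zero, max_eq_left zero_le]
            rw [lintegral_add_right _ measurable_const, lintegral_const, measure_univ, mul_one]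
        _ = ENNReal.ofReal (C + 1) := by
            rw [lintegral_add_left measurable_const, lintegral_sq_sub_gaussianReal,
              lintegral_const, measure_univ, mul_one, ENNReal.ofReal_add hC zero_le_one,
              ENNReal.ofReal_one]
        _ ≤ _ := ENNReal.ofReal_le_ofReal (by linarith)
    · simp only [coordLoss, if_neg hi, zero_add]
      rw [not_not.1 hi]
      exact hnull
  rw [mul_comm, ← div_eq_mul_inv, ENNReal.ofReal_div_of_pos hK]
  refine ENNReal.div_le_div_right ((Finset.sum_le_sum fun i _ => hcoord i).trans ?_) _
  rw [← ENNReal.ofReal_sum_of_nonneg fun i _ => by split_ifs <;> positivity,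
    Finset.sum_add_distrib, sum_support_const hs]
  simp

/-! ### Asymptotics -/

theorem exists_forall_rpow_mul_exp_neg_sq_le (α : ℝ) {c c' : ℝ} (hc : 0 < c)
    (hcc' : c < c') :
    ∃ t₀ : ℝ, ∀ t, t₀ ≤ t → ∀ u, t ≤ u →
      (2 * u) ^ α * (u ^ 2 * Real.exp (-u ^ 2 / 2)) ≤ Real.exp (-(c / c') * t ^ 2 / 2) := by
  have hc' : 0 < c' := hc.trans hcc'
  -- The exponent `1 / 2` is split as `δ + (c / c') / 2`: the first share absorbs the polynomial
  -- factor, the second survives. At `t ^ 2 = 2 * c' * L` it leaves `exp (-c * L)`.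
  set δ := (1 - c / c') / 2
  have hδ : 0 < δ := by
    have : c / c' < 1 := (div_lt_one hc').2 hcc'
    simp only [δ]
    linarith
  have hlim : Tendsto (fun u : ℝ => 2 ^ α * (u ^ (α + 2) * Real.exp (-δ * u))) atTop (𝓝 0) := by
    simpa using (tendsto_rpow_mul_exp_neg_mul_atTop_nhds_zero (α + 2) δ hδ).const_mul (2 ^ α)
  obtain ⟨u₀, hu₀⟩ := eventually_atTop.1 (hlim.eventually_le_const zero_lt_one)
  refine ⟨max u₀ 1, fun t ht u htu => ?_⟩
  have hu1 : 1 ≤ u := (le_max_right _ _).trans (ht.trans htu)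
  have ht1 : 1 ≤ t := (le_max_right _ _).trans ht
  have hu := hu₀ u ((le_max_left _ _).trans (ht.trans htu))
  have hu0 : 0 < u := by linarith
  calc (2 * u) ^ α * (u ^ 2 * Real.exp (-u ^ 2 / 2))
      = 2 ^ α * (u ^ (α + 2) * Real.exp (-δ * u ^ 2)) * Real.exp (-(c / c') * u ^ 2 / 2) := by
        rw [Real.mul_rpow zero_le_two hu0.le, Real.rpow_add hu0, Real.rpow_two,
          show -u ^ 2 / 2 = -δ * u ^ 2 + -(c / c') * u ^ 2 / 2 by simp only [δ]; ring,
          Real.exp_add]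
        ring
    _ ≤ 2 ^ α * (u ^ (α + 2) * Real.exp (-δ * u)) * Real.exp (-(c / c') * t ^ 2 / 2) := by
        have h1 : -δ * u ^ 2 ≤ -δ * u :=
          mul_le_mul_of_nonpos_left (by nlinarith) (by linarith)
        have h2 : -(c / c') * u ^ 2 / 2 ≤ -(c / c') * t ^ 2 / 2 := by
          have : 0 < c / c' := by positivity
          have : t ^ 2 ≤ u ^ 2 := by nlinarith
          nlinarith
        gcongr
    _ ≤ 1 * Real.exp (-(c / c') * t ^ 2 / 2) := by gcongr
    _ = _ := one_mul _

/-- Since `τ ^ (α - 1)` tends to zero, `τ` eventually lies in the range where the rescaled priors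
share their constants; hence one `C` serves all large `n`. -/
theorem exists_eventually_posterior_bounds {p₀ : ℝ → ℝ} {α : ℝ} (hα : 1 < α)
    (hp : IsPolynomialTailPrior p₀ α) {τ : ℕ → ℝ} (hτ : ∀ n, 0 < τ n)
    (hτ0 : Tendsto (fun n => τ n ^ (α - 1)) atTop (𝓝 0)) {t : ℕ → ℝ} (ht : ∀ᶠ n in atTop, 1 ≤ t n)
    (hu : ∀ᶠ n in atTop, ∀ u, t n ≤ u →
      (2 * u) ^ α * (u ^ 2 * Real.exp (-u ^ 2 / 2)) ≤ τ n ^ (α - 1)) :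
    ∃ C : ℝ, 0 ≤ C ∧ ∀ᶠ n in atTop, IsProbabilityMeasure (coordPrior p₀ (τ n)) ∧
      (∀ y, ∫⁻ θ, ENNReal.ofReal ((θ - y) ^ 2 - t n ^ 2)
        ∂(coordPosterior (coordPrior p₀ (τ n)) y) ≤ ENNReal.ofReal C) ∧
      ∀ (f : ℝ → ℝ) (a b T u v w : ℝ), 0 < a → 0 < b → 0 ≤ u → 0 ≤ v → 0 ≤ w →
        (∀ θ, f θ ≤ u + Set.indicator {θ | a < |θ|} (fun _ => v) θ +
          Set.indicator {θ | b < |θ|} (fun θ => w * θ ^ 2) θ) →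
        ∫⁻ y, ∫⁻ θ, ENNReal.ofReal (f θ) ∂(coordPosterior (coordPrior p₀ (τ n)) y)
          ∂(gaussianReal 0 1) ≤
        ENNReal.ofReal (u + v * (C * (τ n ^ (α - 1) * a ^ (1 - α))) +
          w * (C * ((1 + T ^ 2) * (τ n ^ (α - 1) * b ^ (1 - α)) + Real.exp (-T ^ 2 / 8)))) := by
  obtain ⟨c, A₁, A₂, B, τ₀, hc, hA₁, hA₂, hB, hτ₀, hscaled⟩ := hp.exists_isScaledPrior hα
  obtain ⟨C, hC, hsig⟩ := exists_lintegral_excess_le B (by linarith : 0 ≤ α) hc hA₁ hA₂.le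
  obtain ⟨C', hC', hnull⟩ := exists_lintegral_null_le (by linarith : 0 ≤ α) hc hA₁ hA₂.le hB
  refine ⟨max C C', le_max_of_le_left hC, ?_⟩
  have hα' : 0 < α - 1 := by linarith
  have hsmall : ∀ᶠ n in atTop, τ n ≤ τ₀ := by
    filter_upwards [hτ0.eventually_lt_const (Real.rpow_pos_of_pos hτ₀ (α - 1))] with n hn
    exact ((Real.rpow_lt_rpow_iff (hτ n).le hτ₀.le hα').1 hn).le
  filter_upwards [hsmall, ht, hu] with n hn ht hu
  have hg := hscaled (τ n) (hτ n) hn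
  have hlam : 0 ≤ τ n ^ (α - 1) := Real.rpow_nonneg (hτ n).le _
  refine ⟨hg.isProbabilityMeasure, fun y => ?_, fun f a b T u v w ha hb hu hv hw hf => ?_⟩
  · exact (hsig _ _ hlam hg y (t n) ht (Or.inr hu)).trans
      (ENNReal.ofReal_le_ofReal (le_max_left _ _))
  · refine (hnull _ _ hlam hg f a b T u v w ha hb hu hv hw hf).trans
      (ENNReal.ofReal_le_ofReal ?_)
    gcongr <;> exact le_max_right _ _

/-! ### The null risk, normalised, as a function of `L` -/

theorem tendsto_poly_mul_exp_neg (p : ℝ) {b : ℝ} (hb : 0 < b) :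
    Tendsto (fun x : ℝ => (1 + 16 * x) * x ^ p * Real.exp (-b * x)) atTop (𝓝 0) := by
  have h := (tendsto_rpow_mul_exp_neg_mul_atTop_nhds_zero p b hb).add
    ((tendsto_rpow_mul_exp_neg_mul_atTop_nhds_zero (p + 1) b hb).const_mul 16)
  rw [mul_zero, add_zero] at h
  refine h.congr' ?_
  filter_upwards [eventually_gt_atTop 0] with x hx
  rw [Real.rpow_add_one hx.ne']
  ring

/-- The left side is `(n / s)` times the null bound over `L`, at the cutoff `a = exp (-L) * L`. The
mass beyond `a` contributes `C * R`, where `R` is the ratio sent to zero by the upper bound on `τ`.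
The truncation `T = 4 * √L` gives `exp (-T ^ 2 / 8) = exp (-2 * L)`, which beats `n / s = exp L`. -/
theorem null_bound_two {α C L R lam : ℝ} (hL : 0 < L) (hlam : lam = R * (Real.exp (-L) * L) ^ α) :
    Real.exp L * ((Real.exp (-L) * L) ^ 2 + 1 * (C * (lam * (Real.exp (-L) * L) ^ (1 - α))) +
      1 * (C * ((1 + (4 * √L) ^ 2) * (lam * 1 ^ (1 - α)) + Real.exp (-(4 * √L) ^ 2 / 8)))) / L =
    L ^ (1 : ℝ) * Real.exp (-1 * L) + C * R +
      C * (R * ((1 + 16 * L) * L ^ (α - 1) * Real.exp (-(α - 1) * L)) +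
        L ^ (-1 : ℝ) * Real.exp (-1 * L)) := by
  set x := Real.exp (-L) * L with hx
  have hx0 : 0 < x := by positivity
  have hxe : Real.exp L / L = 1 / x := by
    rw [hx, Real.exp_neg]
    field_simp
  have h1 : x ^ α * x ^ (1 - α) = x := by
    rw [← Real.rpow_add hx0, add_sub_cancel, Real.rpow_one]
  have h2 : x ^ α = x * (L ^ (α - 1) * Real.exp (-(α - 1) * L)) := by
    have h3 : x ^ α = x * x ^ (α - 1) := by rw [Real.rpow_sub_one hx0.ne']; field_simp
    rw [h3, hx, Real.mul_rpow (Real.exp_pos _).le hL.le, ← Real.exp_mul,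
      show -L * (α - 1) = -(α - 1) * L by ring]
    ring
  have h3 : (4 * √L) ^ 2 = 16 * L := by rw [mul_pow, Real.sq_sqrt hL.le]; norm_num
  have h4 : Real.exp (-(16 * L) / 8) = x * (L ^ (-1 : ℝ) * Real.exp (-1 * L)) := by
    rw [hx, Real.rpow_neg_one, show -(16 * L) / 8 = -L + -1 * L by ring, Real.exp_add]
    field_simp
  have h5 : L ^ (1 : ℝ) * Real.exp (-1 * L) = x := by rw [hx, Real.rpow_one, neg_one_mul, mul_comm]
  rw [h3, h4, h5, Real.one_rpow, mul_div_right_comm, hxe, hlam, mul_assoc R, h1, h2]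
  field_simp

/-- Here the cutoff is `ρ * exp (-L) * √L`, with `ρ` defined by `hlam` so that the loss below the
cutoff and the loss between it and `1 / √L` are both of normalised order `ρ`. -/
theorem null_bound_one {α C L ρ lam : ℝ} (hL : 0 < L) (hρ : 0 < ρ)
    (hlam : lam = (ρ * (Real.exp (-L) * √L)) ^ α * √L) :
    Real.exp L * (ρ * (Real.exp (-L) * √L) +
      (√L)⁻¹ * (C * (lam * (ρ * (Real.exp (-L) * √L)) ^ (1 - α))) +
      √L * (C * ((1 + (4 * √L) ^ 2) * (lam * ((√L)⁻¹) ^ (1 - α)) +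
        Real.exp (-(4 * √L) ^ 2 / 8)))) / √L =
    ρ + C * ρ + C * (ρ ^ α * ((1 + 16 * L) * L ^ α * Real.exp (-(α - 1) * L)) +
        L ^ (0 : ℝ) * Real.exp (-1 * L)) := by
  have hs : 0 < √L := Real.sqrt_pos.2 hL
  have hsL : √L * √L = L := Real.mul_self_sqrt hL.le
  set x := Real.exp (-L) * √L with hx
  have hx0 : 0 < x := by positivity
  have hxe : Real.exp L / √L = 1 / x := by
    rw [hx, Real.exp_neg]
    field_simp
  have ha : 0 < ρ * x := by positivity
  have h1 : (ρ * x) ^ α * (ρ * x) ^ (1 - α) = ρ * x := by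
    rw [← Real.rpow_add ha, add_sub_cancel, Real.rpow_one]
  have h2 : x ^ α * √L * ((√L)⁻¹) ^ (1 - α) =
      x * (√L)⁻¹ * (L ^ α * Real.exp (-(α - 1) * L)) := by
    have h3 : x ^ α = x * x ^ (α - 1) := by rw [Real.rpow_sub_one hx0.ne']; field_simp
    have h4 : ((√L)⁻¹) ^ (1 - α) = √L ^ (α - 1) := by
      rw [Real.inv_rpow hs.le, ← Real.rpow_neg hs.le, neg_sub]
    have h5 : L ^ α = L ^ (α - 1) * L := by rw [Real.rpow_sub_one hL.ne']; field_simp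
    have h6 : L ^ (α - 1) = √L ^ (α - 1) * √L ^ (α - 1) := by
      rw [← Real.mul_rpow hs.le hs.le, hsL]
    rw [h3, h4, h5, h6, hx, Real.mul_rpow (Real.exp_pos _).le hs.le, ← Real.exp_mul,
      show -L * (α - 1) = -(α - 1) * L by ring]
    field_simp
    rw [Real.sq_sqrt hL.le]
  have h3 : (4 * √L) ^ 2 = 16 * L := by rw [mul_pow, Real.sq_sqrt hL.le]; norm_num
  have h4 : √L * Real.exp (-(16 * L) / 8) = x * (L ^ (0 : ℝ) * Real.exp (-1 * L)) := by
    rw [hx, Real.rpow_zero, show -(16 * L) / 8 = -L + -1 * L by ring, Real.exp_add]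
    ring
  rw [h3, mul_div_right_comm, hxe]
  have h5 : lam * (ρ * x) ^ (1 - α) = ρ * x * √L := by
    rw [hlam, mul_right_comm, h1]
  have h6 : lam * ((√L)⁻¹) ^ (1 - α) = ρ ^ α * (x * (√L)⁻¹ * (L ^ α * Real.exp (-(α - 1) * L))) := by
    rw [hlam, Real.mul_rpow hρ.le hx0.le, ← h2]
    ring
  have h7 : √L * (C * ((1 + 16 * L) * (lam * ((√L)⁻¹) ^ (1 - α)) + Real.exp (-(16 * L) / 8))) =
      x * (C * (ρ ^ α * ((1 + 16 * L) * L ^ α * Real.exp (-(α - 1) * L)) +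
        L ^ (0 : ℝ) * Real.exp (-1 * L))) := by
    rw [h6, mul_left_comm, mul_add (√L), h4]
    field_simp
  rw [h5, h7]
  field_simp

/-! ### The sequences `log (n / s)` and `τ ^ (α - 1)` -/

theorem tendsto_log_div_atTop {s : ℕ → ℕ} (hs_pos : ∀ᶠ n in atTop, 1 ≤ s n)
    (hs : (fun n => (s n : ℝ)) =o[atTop] (fun n => (n : ℝ))) :
    Tendsto (fun n : ℕ => Real.log (n / s n)) atTop atTop := by
  have h0 : Tendsto (fun n : ℕ => (s n : ℝ) / n) atTop (𝓝[>] 0) := by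
    refine tendsto_nhdsWithin_iff.2 ⟨hs.tendsto_div_nhds_zero, ?_⟩
    filter_upwards [hs_pos, eventually_gt_atTop 0] with n h1 h2
    have h1' : (0 : ℝ) < s n := by exact_mod_cast h1
    have h2' : (0 : ℝ) < n := by exact_mod_cast h2
    exact div_pos h1' h2'
  refine Real.tendsto_log_atTop.comp (h0.inv_tendsto_nhdsGT_zero.congr fun n => ?_)
  simp [inv_div]

theorem eventually_exp_log_div {s : ℕ → ℕ} (hs_pos : ∀ᶠ n in atTop, 1 ≤ s n) :
    ∀ᶠ n : ℕ in atTop, (0 : ℝ) < s n ∧ (n : ℝ) = s n * Real.exp (Real.log (n / s n)) ∧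
      (s n : ℝ) / n = Real.exp (-Real.log (n / s n)) := by
  filter_upwards [hs_pos, eventually_gt_atTop 0] with n h1 h2
  have h1' : (0 : ℝ) < s n := by exact_mod_cast h1
  have h2' : (0 : ℝ) < n := by exact_mod_cast h2
  refine ⟨h1', ?_, ?_⟩
  · rw [Real.exp_log (by positivity)]
    field_simp
  · rw [Real.exp_neg, Real.exp_log (by positivity), inv_div]

theorem eventually_exp_decay_le {α c c' : ℝ} (hc : 0 < c) (hcc' : c < c') {L lam : ℕ → ℝ}
    (hL : Tendsto L atTop atTop)
    (hlam : ∀ᶠ n in atTop, Real.exp (-L n) ^ c * L n ^ (1 / 2 : ℝ) ≤ lam n) :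
    ∀ᶠ n in atTop, ∀ u, √(2 * c' * L n) ≤ u →
      (2 * u) ^ α * (u ^ 2 * Real.exp (-u ^ 2 / 2)) ≤ lam n := by
  have hc' : 0 < c' := hc.trans hcc'
  obtain ⟨t₀, ht₀⟩ := exists_forall_rpow_mul_exp_neg_sq_le α hc hcc'
  have ht : Tendsto (fun n => √(2 * c' * L n)) atTop atTop :=
    Real.tendsto_sqrt_atTop.comp (hL.const_mul_atTop (by positivity))
  filter_upwards [hlam, ht.eventually_ge_atTop t₀, hL.eventually_ge_atTop 1] with n h1 h2 h3 u hu
  refine (ht₀ _ h2 u hu).trans (le_trans ?_ h1)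
  rw [← Real.exp_mul, Real.sq_sqrt (by positivity),
    show -(c / c') * (2 * c' * L n) / 2 = -L n * c by field_simp]
  exact le_mul_of_one_le_right (Real.exp_pos _).le (Real.one_le_rpow h3 (by norm_num))

theorem Prec.tendsto_div_zero {a b : ℕ → ℝ} (h : Prec a b) :
    Tendsto (fun n => a n / b n) atTop (𝓝 0) :=
  h.inv_tendsto_atTop.congr fun n => by simp [inv_div]

/-- The comparison sequence `(exp (-L) * L) ^ α` itself tends to zero, so the first upper bound on
`τ` already forces the scale to vanish. -/
theorem tendsto_zero_of_tendsto_div_rpow {α : ℝ} (hα : 1 < α) {L lam : ℕ → ℝ} (hL : Tendsto L atTop atTop)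
    (h : Tendsto (fun n => lam n / (Real.exp (-L n) * L n) ^ α) atTop (𝓝 0)) :
    Tendsto lam atTop (𝓝 0) := by
  have h1 := (tendsto_rpow_mul_exp_neg_mul_atTop_nhds_zero α α (by linarith)).comp hL
  have h2 := h.mul h1
  rw [mul_zero] at h2
  refine h2.congr' ?_
  filter_upwards [hL.eventually_gt_atTop 0] with n hn
  have hx : 0 < Real.exp (-L n) * L n := by positivity
  have : L n ^ α * Real.exp (-α * L n) = (Real.exp (-L n) * L n) ^ α := by
    rw [Real.mul_rpow (Real.exp_pos _).le hn.le, ← Real.exp_mul, mul_comm]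
    congr 2
    ring
  rw [Function.comp_apply, this, div_mul_cancel₀ _ (Real.rpow_pos_of_pos hx α).ne']

theorem tendsto_expectedPosteriorMassOutside_of_le {q : ℝ≥0∞} [Fact (1 ≤ q)] {p₀ : ℝ → ℝ}
    {τ : ℕ → ℝ} {θ' : (n : ℕ) → Fin n → ℝ} {r : ℕ → ℝ} {G : ℕ → ℝ}
    (hG : Tendsto G atTop (𝓝 0))
    (h : ∀ᶠ n in atTop, expectedPosteriorMassOutside q p₀ (τ n) (θ' n) (r n) ≤
      ENNReal.ofReal (G n)) :
    Tendsto (fun n => expectedPosteriorMassOutside q p₀ (τ n) (θ' n) (r n)) atTop (𝓝 0) := by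
  have hG' := ENNReal.tendsto_ofReal hG
  rw [ENNReal.ofReal_zero] at hG'
  exact tendsto_of_tendsto_of_tendsto_of_le_of_le' tendsto_const_nhds hG'
    (Eventually.of_forall fun _ => zero_le) h

theorem tendsto_nhdsGT_zero_of_continuous {f : ℝ → ℝ} (hf : Continuous f) :
    Tendsto f (𝓝[>] 0) (𝓝 (f 0)) :=
  hf.continuousAt.tendsto.mono_left nhdsWithin_le_nhds

/-! ### Limits of the constants -/

theorem tendsto_C₁ : Tendsto C₁ (𝓝[>] 0) (𝓝 √2) := by
  have h := tendsto_nhdsGT_zero_of_continuous (f := C₁) (by unfold C₁; fun_prop)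
  simpa [C₁] using h

theorem tendsto_C₂ : Tendsto C₂ (𝓝[>] 0) (𝓝 √2) := by
  have h := tendsto_nhdsGT_zero_of_continuous (f := C₂) (by unfold C₂; fun_prop)
  simpa [C₂] using h

theorem sq_le_add_indicator {a : ℝ} (θ : ℝ) :
    θ ^ 2 ≤ a ^ 2 + Set.indicator {θ : ℝ | a < |θ|} (fun _ => 1) θ +
      Set.indicator {θ : ℝ | 1 < |θ|} (fun θ => 1 * θ ^ 2) θ := by
  simp only [Set.indicator, Set.mem_ofPred_eq]
  split_ifs with h1 h2 h2
  · nlinarith [sq_nonneg a]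
  · rw [← sq_abs]; nlinarith [sq_nonneg a, abs_nonneg θ]
  · nlinarith [sq_nonneg a]
  · rw [← sq_abs]; nlinarith [abs_nonneg θ]

/-- Beyond `b⁻¹` the absolute value is dominated by `b * θ ^ 2`, which brings the `ℓ₁` loss under
the second-moment estimate. It is used with `b = √L`, so that intermediate values cost only `1 /
√L`. -/
theorem abs_le_add_indicator {a b : ℝ} (ha : 0 ≤ a) (hb : 0 < b) (θ : ℝ) :
    |θ| ≤ a + Set.indicator {θ : ℝ | a < |θ|} (fun _ => b⁻¹) θ +
      Set.indicator {θ : ℝ | b⁻¹ < |θ|} (fun θ => b * θ ^ 2) θ := by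
  have hbi : 0 < b⁻¹ := inv_pos.2 hb
  have hlarge : b⁻¹ < |θ| → |θ| ≤ b * θ ^ 2 := fun h => by
    rw [← sq_abs, sq, ← mul_assoc]
    refine le_mul_of_one_le_left (abs_nonneg θ) ?_
    rw [inv_lt_iff_one_lt_mul₀ hb, mul_comm] at h
    linarith
  simp only [Set.indicator, Set.mem_ofPred_eq]
  split_ifs with h1 h2 h2
  · linarith [hlarge h2]
  · linarith
  · linarith [hlarge h2]
  · linarith

/-- Posterior contraction in the `ℓ₂` norm. -/
theorem tendsto_expectedPosteriorMassOutside_two {p₀ : ℝ → ℝ} {α : ℝ} (hα : 1 < α) (hp₀ : IsPolynomialTailPrior p₀ α)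
    {s : ℕ → ℕ} (hs_pos : ∀ᶠ n in atTop, 1 ≤ s n)
    (hs : (fun n => (s n : ℝ)) =o[atTop] (fun n => (n : ℝ)))
    {θstar : (n : ℕ) → Fin n → ℝ} (hθstar : ∀ n, Set.ncard {i | θstar n i ≠ 0} = s n)
    {τ : ℕ → ℝ} (hτ_pos : ∀ n, 0 < τ n) {ω c : ℝ} (hω : 0 < ω) (hc : 0 < c) (hcω : c < 1 + ω / 2)
    (hτ_lower : ∀ᶠ n : ℕ in atTop,
      ((s n : ℝ) / n) ^ c * Real.log (n / s n) ^ (1 / 2 : ℝ) ≤ τ n ^ (α - 1))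
    (hτ_upper : Prec (fun n => τ n ^ (α - 1))
      (fun n => ((s n : ℝ) / n * Real.log (n / s n)) ^ α)) :
    Tendsto (fun n => expectedPosteriorMassOutside 2 p₀ (τ n) (θstar n)
        (C₁ ω * (s n * Real.log (n / s n)) ^ (1 / 2 : ℝ))) atTop (𝓝 0) := by
  have hL := tendsto_log_div_atTop hs_pos hs
  have hexp := eventually_exp_log_div hs_pos
  set L : ℕ → ℝ := fun n => Real.log (n / s n) with hLdef
  have hR : Tendsto (fun n => τ n ^ (α - 1) / (Real.exp (-L n) * L n) ^ α) atTop (𝓝 0) := by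
    refine (Prec.tendsto_div_zero hτ_upper).congr' ?_
    filter_upwards [hexp] with n hn
    rw [hn.2.2]
  have hlow : ∀ᶠ n in atTop, Real.exp (-L n) ^ c * L n ^ (1 / 2 : ℝ) ≤ τ n ^ (α - 1) := by
    filter_upwards [hexp, hτ_lower] with n hn h
    rwa [hn.2.2] at h
  -- The gap `c < c'` pays for polynomial factors in the Gaussian tail; `c' < 1 + ω / 2` gives `√(2
  -- * c') ≤ √(2 + ω)`.
  obtain ⟨c', hcc', hc'ω⟩ := exists_between hcω
  have hc' : 0 < c' := hc.trans hcc'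
  have ht : Tendsto (fun n => √(2 * c' * L n)) atTop atTop :=
    Real.tendsto_sqrt_atTop.comp (hL.const_mul_atTop (by positivity))
  obtain ⟨C, hC, hbounds⟩ := exists_eventually_posterior_bounds hα hp₀ hτ_pos
    (tendsto_zero_of_tendsto_div_rpow hα hL hR) (ht.eventually_ge_atTop 1)
    (eventually_exp_decay_le hc hcc' hL hlow)
  set R : ℕ → ℝ := fun n => τ n ^ (α - 1) / (Real.exp (-L n) * L n) ^ α with hRdef
  -- The slack `√ω` of `C₁ ω` is shared equally among the three parts of the error.
  set κ := √ω / 3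
  have hκ : 0 < κ := by positivity
  refine tendsto_expectedPosteriorMassOutside_of_le
    (G := fun n => ((C + 1) * (L n)⁻¹ + (L n ^ (1 : ℝ) * Real.exp (-1 * L n) + C * R n +
      C * (R n * ((1 + 16 * L n) * L n ^ (α - 1) * Real.exp (-(α - 1) * L n)) +
        L n ^ (-1 : ℝ) * Real.exp (-1 * L n)))) * (κ ^ 2)⁻¹) ?_ ?_
  · have e1 := (tendsto_rpow_mul_exp_neg_mul_atTop_nhds_zero 1 1 one_pos).comp hL
    have e2 := (tendsto_rpow_mul_exp_neg_mul_atTop_nhds_zero (-1) 1 one_pos).comp hL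
    have e3 := (tendsto_poly_mul_exp_neg (α - 1) (by linarith : 0 < α - 1)).comp hL
    have e4 := hL.inv_tendsto_atTop
    have := (((e4.const_mul (C + 1)).add ((e1.add (hR.const_mul C)).add
      (((hR.mul e3).add e2).const_mul C))).mul_const (κ ^ 2)⁻¹)
    simpa using this
  · filter_upwards [hexp, hbounds, hL.eventually_ge_atTop 1] with n ⟨hsn, hn, hεn⟩
      ⟨hprob, hsig, hnull⟩ hL1
    have hL0 : 0 < L n := by linarith
    have hx : 0 < Real.exp (-L n) * L n := by positivity
    have hlam : τ n ^ (α - 1) = R n * (Real.exp (-L n) * L n) ^ α := by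
      rw [hRdef, div_mul_cancel₀ _ (Real.rpow_pos_of_pos hx α).ne']
    have hlam0 : 0 ≤ τ n ^ (α - 1) := Real.rpow_nonneg (hτ_pos n).le _
    have hN := hnull (fun θ => θ ^ 2) (Real.exp (-L n) * L n) 1 (4 * √(L n))
      ((Real.exp (-L n) * L n) ^ 2) 1 1 hx one_pos (by positivity) zero_le_one zero_le_one
      fun θ => sq_le_add_indicator θ
    set N := (Real.exp (-L n) * L n) ^ 2 +
      1 * (C * (τ n ^ (α - 1) * (Real.exp (-L n) * L n) ^ (1 - α))) +
      1 * (C * ((1 + (4 * √(L n)) ^ 2) * (τ n ^ (α - 1) * 1 ^ (1 - α)) +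
        Real.exp (-(4 * √(L n)) ^ 2 / 8))) with hNdef
    have hN0 : 0 ≤ N := by positivity
    have hr : √(s n : ℝ) * √(2 * c' * L n) + 3 * (κ * √(s n * L n)) ≤
        C₁ ω * (s n * L n) ^ (1 / 2 : ℝ) := by
      rw [← Real.sqrt_eq_rpow, ← Real.sqrt_mul hsn.le,
        show (s n : ℝ) * (2 * c' * L n) = 2 * c' * (s n * L n) by ring,
        Real.sqrt_mul (by positivity), C₁, add_mul,
        show 3 * (κ * √(s n * L n)) = √ω * √(s n * L n) by simp only [κ]; ring]
      gcongr
      linarith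
    have key := expectedPosteriorMassOutside_le_of_coordLoss (q := 2) (hθstar n)
      (by fun_prop : Measurable fun θ : ℝ => θ ^ 2) hC hN0
      (by positivity : 0 < (κ * √(s n * L n)) ^ 2) hsig hN
      (le_sum_coordLoss_of_le_norm_two (hθstar n) (Real.sqrt_nonneg _) (by positivity) hr)
    refine key.trans (le_of_eq (congrArg ENNReal.ofReal ?_))
    rw [← null_bound_two hL0 hlam, ← hNdef, mul_pow, Real.sq_sqrt (by positivity)]
    have hnN : (n : ℝ) * N = s n * Real.exp (L n) * N := congrArg (· * N) hn
    rw [hnN]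
    field_simp

/-- Posterior contraction in the `ℓ₁` norm. -/
theorem tendsto_expectedPosteriorMassOutside_one {p₀ : ℝ → ℝ} {α : ℝ} (hα : 1 < α) (hp₀ : IsPolynomialTailPrior p₀ α)
    {s : ℕ → ℕ} (hs_pos : ∀ᶠ n in atTop, 1 ≤ s n)
    (hs : (fun n => (s n : ℝ)) =o[atTop] (fun n => (n : ℝ)))
    {θstar : (n : ℕ) → Fin n → ℝ} (hθstar : ∀ n, Set.ncard {i | θstar n i ≠ 0} = s n)
    {τ : ℕ → ℝ} (hτ_pos : ∀ n, 0 < τ n) {ω c : ℝ} (hω : 0 < ω) (hc : 0 < c) (hcω : c < 1 + ω / 2)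
    (hτ_lower : ∀ᶠ n : ℕ in atTop,
      ((s n : ℝ) / n) ^ c * Real.log (n / s n) ^ (1 / 2 : ℝ) ≤ τ n ^ (α - 1))
    (hτ_upper : Prec (fun n => τ n ^ (α - 1))
      (fun n => ((s n : ℝ) / n * Real.log (n / s n)) ^ α))
    (hτ_upper' : Prec (fun n => τ n ^ (α - 1))
        (fun n => ((s n : ℝ) / n) ^ α * Real.log (n / s n) ^ ((α + 1) / 2))) :
    Tendsto (fun n => expectedPosteriorMassOutside 1 p₀ (τ n) (θstar n)
        (s n * C₂ ω * Real.log (n / s n) ^ (1 / 2 : ℝ))) atTop (𝓝 0) := by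
  have hL := tendsto_log_div_atTop hs_pos hs
  have hexp := eventually_exp_log_div hs_pos
  set L : ℕ → ℝ := fun n => Real.log (n / s n) with hLdef
  have hR : Tendsto (fun n => τ n ^ (α - 1) / (Real.exp (-L n) * L n) ^ α) atTop (𝓝 0) := by
    refine (Prec.tendsto_div_zero hτ_upper).congr' ?_
    filter_upwards [hexp] with n hn
    rw [hn.2.2]
  have hα0 : 0 < α := by linarith
  -- Solves `τ ^ (α - 1) = (ρ * exp (-L) * √L) ^ α * √L`; the extra upper bound on `τ` is equivalent
  -- to `ρ ^ α → 0`.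
  set ρ : ℕ → ℝ := fun n =>
    (τ n ^ (α - 1) / ((Real.exp (-L n) * √(L n)) ^ α * √(L n))) ^ (1 / α) with hρdef
  have hρ : Tendsto ρ atTop (𝓝 0) := by
    have h1 : Tendsto (fun n => τ n ^ (α - 1) / ((Real.exp (-L n) * √(L n)) ^ α * √(L n)))
        atTop (𝓝 0) := by
      refine (Prec.tendsto_div_zero hτ_upper').congr' ?_
      filter_upwards [hexp, hL.eventually_gt_atTop 0] with n hn hL0
      rw [hn.2.2]
      congr 1
      rw [Real.mul_rpow (Real.exp_pos _).le (Real.sqrt_nonneg _), mul_assoc]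
      congr 1
      rw [Real.sqrt_eq_rpow, ← Real.rpow_mul hL0.le, ← Real.rpow_add hL0]
      congr 1
      ring
    have h2 := h1.rpow_const (p := 1 / α) (Or.inr (by positivity))
    rwa [Real.zero_rpow (by positivity)] at h2
  have hρα : Tendsto (fun n => ρ n ^ α) atTop (𝓝 0) := by
    have h2 := hρ.rpow_const (p := α) (Or.inr hα0.le)
    rwa [Real.zero_rpow hα0.ne'] at h2
  have hlow : ∀ᶠ n in atTop, Real.exp (-L n) ^ c * L n ^ (1 / 2 : ℝ) ≤ τ n ^ (α - 1) := by
    filter_upwards [hexp, hτ_lower] with n hn h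
    rwa [hn.2.2] at h
  obtain ⟨c', hcc', hc'ω⟩ := exists_between hcω
  have hc' : 0 < c' := hc.trans hcc'
  have ht : Tendsto (fun n => √(2 * c' * L n)) atTop atTop :=
    Real.tendsto_sqrt_atTop.comp (hL.const_mul_atTop (by positivity))
  obtain ⟨C, hC, hbounds⟩ := exists_eventually_posterior_bounds hα hp₀ hτ_pos
    (tendsto_zero_of_tendsto_div_rpow hα hL hR) (ht.eventually_ge_atTop 1)
    (eventually_exp_decay_le hc hcc' hL hlow)
  set κ := √(ω / 5)
  have hκ : 0 < κ := by positivity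
  have hsqrtL : Tendsto (fun n => √(ω ^ 2 / 5) * √(L n)) atTop atTop :=
    (Real.tendsto_sqrt_atTop.comp hL).const_mul_atTop (by positivity)
  refine tendsto_expectedPosteriorMassOutside_of_le
    (G := fun n => ((C + 1) * (√(L n))⁻¹ + (ρ n + C * ρ n +
      C * (ρ n ^ α * ((1 + 16 * L n) * L n ^ α * Real.exp (-(α - 1) * L n)) +
        L n ^ (0 : ℝ) * Real.exp (-1 * L n)))) * κ⁻¹) ?_ ?_
  · have e2 := (tendsto_rpow_mul_exp_neg_mul_atTop_nhds_zero 0 1 one_pos).comp hL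
    have e3 := (tendsto_poly_mul_exp_neg α (by linarith : 0 < α - 1)).comp hL
    have e4 := (Real.tendsto_sqrt_atTop.comp hL).inv_tendsto_atTop
    have := (((e4.const_mul (C + 1)).add ((hρ.add (hρ.const_mul C)).add
      (((hρα.mul e3).add e2).const_mul C))).mul_const κ⁻¹)
    simpa using this
  · filter_upwards [hexp, hbounds, hL.eventually_ge_atTop 1, ht.eventually_ge_atTop 1,
      hsqrtL.eventually_ge_atTop 1] with n ⟨hsn, hn, hεn⟩ ⟨hprob, hsig, hnull⟩ hL1 ht1 hsq
    have hL0 : 0 < L n := by linarith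
    have hsL : 0 < √(L n) := Real.sqrt_pos.2 hL0
    have hlam0 : 0 < τ n ^ (α - 1) := Real.rpow_pos_of_pos (hτ_pos n) _
    have hρ0 : 0 < ρ n := by positivity
    have ha : 0 < ρ n * (Real.exp (-L n) * √(L n)) := by positivity
    have hlam : τ n ^ (α - 1) = (ρ n * (Real.exp (-L n) * √(L n))) ^ α * √(L n) := by
      rw [Real.mul_rpow hρ0.le (by positivity), hρdef, ← Real.rpow_mul (by positivity),
        one_div_mul_cancel hα0.ne', Real.rpow_one]
      field_simp
    have hN := hnull (fun θ => |θ|) (ρ n * (Real.exp (-L n) * √(L n))) (√(L n))⁻¹ (4 * √(L n))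
      (ρ n * (Real.exp (-L n) * √(L n))) (√(L n))⁻¹ √(L n) ha (by positivity) ha.le
      (by positivity) hsL.le fun θ => abs_le_add_indicator ha.le hsL θ
    set N := ρ n * (Real.exp (-L n) * √(L n)) +
      (√(L n))⁻¹ * (C * (τ n ^ (α - 1) * (ρ n * (Real.exp (-L n) * √(L n))) ^ (1 - α))) +
      √(L n) * (C * ((1 + (4 * √(L n)) ^ 2) * (τ n ^ (α - 1) * ((√(L n))⁻¹) ^ (1 - α)) +
        Real.exp (-(4 * √(L n)) ^ 2 / 8))) with hNdef
    have hN0 : 0 ≤ N := by positivity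
    -- The three terms of `C₂ ω` have separate roles: `√(2 + ω)` covers `t`, `√(ω ^ 2 / 5) * √L`
    -- eventually exceeds the extra `1` from the noise, and `√(ω / 5) = κ` is the level for Markov's
    -- inequality.
    have hr : (s n : ℝ) * (√(2 * c' * L n) + 1) + κ * (s n * √(L n)) ≤
        s n * C₂ ω * L n ^ (1 / 2 : ℝ) := by
      rw [← Real.sqrt_eq_rpow, mul_left_comm κ, ← mul_add, mul_assoc (s n : ℝ)]
      refine mul_le_mul_of_nonneg_left ?_ hsn.le
      have : √(2 * c' * L n) ≤ √(2 + ω) * √(L n) := by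
        rw [Real.sqrt_mul (by positivity)]
        gcongr
        linarith
      rw [C₂]
      linarith
    have key := expectedPosteriorMassOutside_le_of_coordLoss (q := 1) (hθstar n)
      (by fun_prop : Measurable fun θ : ℝ => |θ|) hC hN0
      (by positivity : 0 < κ * (s n * √(L n))) hsig hN
      (le_sum_coordLoss_of_le_norm_one (hθstar n) ht1 hr)
    refine key.trans (le_of_eq (congrArg ENNReal.ofReal ?_))
    rw [← null_bound_one hL0 hρ0 hlam, ← hNdef]
    have hnN : (n : ℝ) * N = s n * Real.exp (L n) * N := congrArg (· * N) hn
    rw [hnN]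
    field_simp

end SparseNormalMeans

end

theorem theorem1
    -- the prior density and its tail order
    (p₀ : ℝ → ℝ) (α : ℝ) (hα : 1 < α) (hp₀ : IsPolynomialTailPrior p₀ α)
    -- the true mean vectors, with `s n` nonzero entries in dimension `n`, where `1 ≤ s = o(n)`
    (s : ℕ → ℕ) (hs_pos : ∀ᶠ n in atTop, 1 ≤ s n)
    (hs : (fun n => (s n : ℝ)) =o[atTop] (fun n => (n : ℝ)))
    (θstar : (n : ℕ) → Fin n → ℝ)
    (hθstar : ∀ n, Set.ncard {i | θstar n i ≠ 0} = s n)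
    -- the global scale
    (τ : ℕ → ℝ) (hτ_pos : ∀ n, 0 < τ n)
    (ω : ℝ) (hω : 0 < ω)
    (hτ_lower : ∃ c : ℝ, 0 < c ∧ c < 1 + ω / 2 ∧ ∀ᶠ n : ℕ in atTop,
      ((s n : ℝ) / n) ^ c * Real.log (n / s n) ^ (1 / 2 : ℝ) ≤ τ n ^ (α - 1))
    (hτ_upper : Prec (fun n => τ n ^ (α - 1))
      (fun n => ((s n : ℝ) / n * Real.log (n / s n)) ^ α)) :
    Tendsto (fun n => expectedPosteriorMassOutside 2 p₀ (τ n) (θstar n)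
        (C₁ ω * (s n * Real.log (n / s n)) ^ (1 / 2 : ℝ))) atTop (𝓝 0) ∧
    (Prec (fun n => τ n ^ (α - 1))
        (fun n => ((s n : ℝ) / n) ^ α * Real.log (n / s n) ^ ((α + 1) / 2)) →
      Tendsto (fun n => expectedPosteriorMassOutside 1 p₀ (τ n) (θstar n)
        (s n * C₂ ω * Real.log (n / s n) ^ (1 / 2 : ℝ))) atTop (𝓝 0)) ∧
    Tendsto C₁ (𝓝[>] 0) (𝓝 √2) ∧
    Tendsto C₂ (𝓝[>] 0) (𝓝 √2) := by
  obtain ⟨c, hc, hcω, hlow⟩ := hτ_lower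
  exact ⟨tendsto_expectedPosteriorMassOutside_two hα hp₀ hs_pos hs hθstar hτ_pos hω hc hcω hlow
      hτ_upper,
    fun h => tendsto_expectedPosteriorMassOutside_one hα hp₀ hs_pos hs hθstar hτ_pos hω hc hcω hlow
      hτ_upper h,
    tendsto_C₁, tendsto_C₂⟩
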